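/- Consider an infinite-horizon Markov decision process with measurable state space $\mathcal S$ and action space $\mathcal A$, where $\mathcal A$ carries a finite nonzero reference measure $da$, with a Markov transition kernel $P(ds'\mid s,a)$ (for instance one given by a density $p_{\mathbf s}(s'\mid s,a)$) and a measurable reward $r:\mathcal S\times\mathcal A\to[r_{\min},r_{\max}]$. Let $\gamma\in[0,1)$ be the discount factor and $\alpha>0$ the entropy weight. A policy $\pi$ is a jointly measurable family of probability densities $\pi(\cdot\mid s)$ with respect to $da$; $\mathcal H(\pi(\cdot\mid s))=-\int_{\mathcal A}\pi(a\mid s)\log\pi(a\mid s)\,da\in[-\infty,\infty)$ is its differential entropy. A policy is optimal from the initial state distribution $\rho_0$ if it maximizes, among all policies, the discounted maximum-entropy objective $$J_{\rho_0}(\pi)=\mathbb E_{s_0\sim\rho_0,\ \pi}\Big[\sum_{t=0}^\infty\gamma^t\big(r(s_t,a_t)+\alpha\mathcal H(\pi(\cdot\mid s_t))\big)\Big]\in[-\infty,\infty).$$ For a policy $\pi$ let $$Q^\pi_{\rm soft}(s,a)=r(s,a)+\mathbb E_{\pi,\ s_0=s,\ a_0=a}\Big[\sum_{l=1}^\infty\gamma^l\big(r(s_l,a_l)+\alpha\mathcal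 H(\pi(\cdot\mid s_l))\big)\Big],\qquad V^\pi_{\rm soft}(s)=\alpha\log\int_{\mathcal A}\exp\big(\tfrac1\alpha Q^\pi_{\rm soft}(s,a')\big)\,da'.$$ Say that $\pi$ is energy-based at $s$ if $Q^\pi_{\rm soft}(s,a)$ is finite for almost every $a$, $\int_{\mathcal A}\exp(\frac1\alpha Q^\pi_{\rm soft}(s,a'))\,da'<\infty$, and $$\pi(a\mid s)=\exp\Big(\tfrac1\alpha\big(Q^\pi_{\rm soft}(s,a)-V^\pi_{\rm soft}(s)\big)\Big)\quad\text{for almost every } a.$$ Then: 1. There is a policy $\pi^*$ that is optimal from every initial distribution, that satisfies $Q^{\pi}_{\rm soft}(s,a)\le Q^{\pi^*}_{\rm soft}(s,a)$ for every policy $\pi$ and all $s,a$, whose soft Q-function $Q^*_{\rm soft}=Q^{\pi^*}_{\rm soft}$ is bounded with finite partition functions $\int_{\mathcal A}\exp(\frac1\alpha Q^*_{\rm soft}(s,a'))\,da'$, and for which, with $V^*_{\rm soft}=V^{\pi^*}_{\rm soft}$, for all $s$ and all $a$, $$\pi^*(a\mid s)=\exp\Big(\tfrac1\alpha\big(Q^*_{\rm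 soft}(s,a)-V^*_{\rm soft}(s)\big)\Big).$$ 2. A policy $\pi$ is optimal from every initial distribution if and only if $Q^\pi_{\rm soft}$ is bounded and $\pi$ is energy-based at every state $s$. 3. If $\pi$ is optimal from one given initial distribution $\rho_0$, then for every time $t$ with $\gamma^t>0$, $\pi$ is energy-based at almost every state $s$ with respect to the law of $s_t$ under $\pi$ started from $\rho_0$. -/

import Mathlib

open MeasureTheory ProbabilityTheory
open scoped ENNReal

namespace MaxEntRL

noncomputable section

variable {S A : Type*} [MeasurableSpace S] [MeasurableSpace A]

/-- A stationary stochastic policy with action densities `π(a | s)` with respect to the reference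
measure `ν` (`da`) on the action space. -/
structure Policy (S : Type*) {A : Type*} [MeasurableSpace S] [MeasurableSpace A]
    (ν : Measure A) where
  /-- the density `π(a | s)` -/
  dens : S → A → ℝ
  measurable_dens : Measurable (Function.uncurry dens)
  nonneg : ∀ s a, 0 ≤ dens s a
  lintegral_eq_one : ∀ s, ∫⁻ a, ENNReal.ofReal (dens s a) ∂ν = 1

/-- The action distribution `π(· | s)`, as a kernel. -/
def Policy.kernel {ν : Measure A} [SFinite ν] (π : Policy S ν) : Kernel S A :=
  Kernel.withDensity (Kernel.const S ν) (fun s a => ENNReal.ofReal (π.dens s a))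

instance {ν : Measure A} [SFinite ν] (π : Policy S ν) : IsMarkovKernel π.kernel := by
  refine ⟨fun s => ⟨?_⟩⟩
  have hm : Measurable (Function.uncurry fun s a => ENNReal.ofReal (π.dens s a)) :=
    π.measurable_dens.ennreal_ofReal
  rw [Policy.kernel, Kernel.withDensity_apply' _ hm, Measure.restrict_univ, Kernel.const_apply]
  exact π.lintegral_eq_one s

/-- The differential entropy `-∫ f(a) log f(a) da` of a density `f`, as an extended real number:
the integral of the positive part minus the integral of the negative part. -/
def diffEntropy (ν : Measure A) (f : A → ℝ) : EReal :=
  ((∫⁻ a, ENNReal.ofReal (Real.negMulLog (f a)) ∂ν : ℝ≥0∞) : EReal) -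
    ((∫⁻ a, ENNReal.ofReal (-Real.negMulLog (f a)) ∂ν : ℝ≥0∞) : EReal)

/-- The transition kernel of the state-action process under `π`: from `(s, a)`, draw the next state
from `P (s, a)` and then the next action from `π`. -/
def stepKernel {ν : Measure A} [SFinite ν] (P : Kernel (S × A) S) (π : Policy S ν) :
    Kernel (S × A) (S × A) :=
  P ⊗ₖ π.kernel.comap Prod.snd measurable_snd

instance {ν : Measure A} [SFinite ν] (P : Kernel (S × A) S) [IsMarkovKernel P]
    (π : Policy S ν) : IsMarkovKernel (stepKernel P π) := by
  unfold stepKernel; infer_instance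

/-- The law of the trajectory `(s₀, a₀), (s₁, a₁), …` when `(s₀, a₀)` has law `μ` and all later
actions are drawn from `π`. -/
def trajLaw {ν : Measure A} [SFinite ν] (P : Kernel (S × A) S) [IsMarkovKernel P]
    (π : Policy S ν) (μ : Measure (S × A)) : Measure (ℕ → S × A) :=
  Kernel.trajMeasure (X := fun _ => S × A) μ (fun n =>
    (stepKernel P π).comap
      (fun h : (i : Finset.Iic n) → S × A => h ⟨n, Finset.mem_Iic.2 le_rfl⟩)
      (measurable_pi_apply _))

/-- The joint law of `(s₀, a₀)` when `s₀` has law `ρ₀` and `a₀` is drawn from `π`. -/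
def initLaw {ν : Measure A} [SFinite ν] (π : Policy S ν) (ρ₀ : Measure S) : Measure (S × A) :=
  ρ₀ ⊗ₘ π.kernel

/-- The state marginal at time `t` of the trajectory law of `π` started from `ρ₀`. -/
def stateLaw {ν : Measure A} [SFinite ν] (P : Kernel (S × A) S) [IsMarkovKernel P]
    (π : Policy S ν) (ρ₀ : Measure S) (t : ℕ) : Measure S :=
  (trajLaw P π (initLaw π ρ₀)).map (fun ω => (ω t).1)

/-- The expectation of `∑_{t ≥ k} γ ^ t * g (s_t, a_t)` under a law `μ` of trajectories, for an
extended-real-valued `g`: the positive parts minus the negative parts. -/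
def expDiscountedSum (μ : Measure (ℕ → S × A)) (γ : ℝ) (k : ℕ) (g : S × A → EReal) : EReal :=
  ((∫⁻ ω, ∑' l : ℕ, ENNReal.ofReal (γ ^ (k + l)) * (g (ω (k + l))).toENNReal ∂μ : ℝ≥0∞) : EReal) -
    ((∫⁻ ω, ∑' l : ℕ, ENNReal.ofReal (γ ^ (k + l)) * (-g (ω (k + l))).toENNReal ∂μ : ℝ≥0∞) : EReal)

/-- The reward augmented by the entropy term, `r(s, a) + α H(π(· | s))`. -/
def softReward {ν : Measure A} (r : S → A → ℝ) (α : ℝ) (π : Policy S ν) (x : S × A) : EReal :=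
  (r x.1 x.2 : EReal) + (α : EReal) * diffEntropy ν (π.dens x.1)

/-- The discounted maximum entropy objective
`E_{s₀ ∼ ρ₀, π} ∑_{t ≥ 0} γ ^ t (r(s_t, a_t) + α H(π(· | s_t)))`. -/
def objective {ν : Measure A} [SFinite ν] (P : Kernel (S × A) S) [IsMarkovKernel P]
    (r : S → A → ℝ) (γ α : ℝ) (ρ₀ : Measure S) (π : Policy S ν) : EReal :=
  expDiscountedSum (trajLaw P π (initLaw π ρ₀)) γ 0 (softReward r α π)

/-- `π` maximizes the maximum entropy objective with initial state distribution `ρ₀`. -/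
def IsMaxEntOptimal {ν : Measure A} [SFinite ν] (P : Kernel (S × A) S) [IsMarkovKernel P]
    (r : S → A → ℝ) (γ α : ℝ) (ρ₀ : Measure S) (π : Policy S ν) : Prop :=
  ∀ π' : Policy S ν, objective P r γ α ρ₀ π' ≤ objective P r γ α ρ₀ π

/-- The soft Q-function of `π`: `r(s, a) + E_π ∑_{l ≥ 1} γ ^ l (r_l + α H(π(· | s_l)))`, with
trajectories that start at `(s, a)`. -/
def softQ {ν : Measure A} [SFinite ν] (P : Kernel (S × A) S) [IsMarkovKernel P]
    (r : S → A → ℝ) (γ α : ℝ) (π : Policy S ν) (s : S) (a : A) : EReal :=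
  (r s a : EReal) +
    expDiscountedSum (trajLaw P π (Measure.dirac (s, a))) γ 1 (softReward r α π)

/-- The soft value of `π`: `α log ∫ exp (Q(s, a') / α) da'`. -/
def softV {ν : Measure A} [SFinite ν] (P : Kernel (S × A) S) [IsMarkovKernel P]
    (r : S → A → ℝ) (γ α : ℝ) (π : Policy S ν) (s : S) : ℝ :=
  α * Real.log (∫ a, Real.exp ((softQ P r γ α π s a).toReal / α) ∂ν)

/-- At the state `s`, the soft Q-function of `π` is finite for almost every action, its partition
function is finite, and `π(a | s) = exp ((Q(s, a) - V(s)) / α)` for almost every action `a`. -/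
def IsEnergyBasedAt {ν : Measure A} [SFinite ν] (P : Kernel (S × A) S) [IsMarkovKernel P]
    (r : S → A → ℝ) (γ α : ℝ) (π : Policy S ν) (s : S) : Prop :=
  (∀ᵐ a ∂ν, softQ P r γ α π s a ≠ ⊥ ∧ softQ P r γ α π s a ≠ ⊤) ∧
  Integrable (fun a => Real.exp ((softQ P r γ α π s a).toReal / α)) ν ∧
  ∀ᵐ a ∂ν, π.dens s a =
    Real.exp (((softQ P r γ α π s a).toReal - softV P r γ α π s) / α)

/-- The soft Q-function of `π` is finite and bounded. -/
def HasBoundedSoftQ {ν : Measure A} [SFinite ν] (P : Kernel (S × A) S) [IsMarkovKernel P]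
    (r : S → A → ℝ) (γ α : ℝ) (π : Policy S ν) : Prop :=
  ∃ C : ℝ, ∀ s a, ((-C : ℝ) : EReal) ≤ softQ P r γ α π s a ∧ softQ P r γ α π s a ≤ (C : EReal)

end

end MaxEntRL

namespace MaxEntRL

noncomputable section

variable {S A : Type*} [MeasurableSpace S] [MeasurableSpace A]

/-! Everything follows from one exact formula for the loss of a policy. The soft Bellman operator `V
↦ softMax (qOf V)` is a `γ`-contraction on bounded functions, so it has a bounded measurable fixed
point `V` (`exists_isSoftValue`). The fixed-point equation says that `exp ((q - V) / α)`, with `q =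
qOf V`, is a probability density in the action at every state.

By the Gibbs variational identity (`diffEntropy_eq_sub_gibbsGap`), the entropy of `π(· | s)` is its
cross entropy against this Gibbs density minus a relative entropy. Hence `r + α H` equals `r - E_π q
+ V` minus a nonnegative, possibly infinite, `regret`. Along a trajectory that follows `π`, the
expectation of the bounded part is `E V(s_t) - γ E V(s_{t+1})`, and the discounted sum telescopes.
So the objective is `∫ V dρ₀` minus the expected discounted regret, and the soft Q-function is `q`
minus the future regret.

The Gibbs policy has no regret and is therefore optimal. Conversely, optimality from `ρ₀` kills the
expected regret at each time of positive weight, and almost everywhere there the Q-function is `q`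
and the policy is the Gibbs policy.

It remains to see that a policy which is energy-based for its own bounded Q-function has no regret.
If its future regret is at most `c` everywhere, the energy-based form bounds the regret from the
current state on by `c` (`regret_add_lintegral_discountedRegret_le`), so the future regret is at
most `γ c`. Iterating from a finite bound gives zero. -/

/-- The operator `f ↦ (x ↦ ∫⁻ y, f y ∂κ x)` of a kernel. -/
def stepExp {X : Type*} [MeasurableSpace X] (κ : Kernel X X) (f : X → ℝ≥0∞) (x : X) : ℝ≥0∞ :=
  ∫⁻ y, f y ∂κ x

/-! ### Iterates of a kernel acting on nonnegative functions. -/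

section stepExp

variable {X : Type*} [MeasurableSpace X] {κ : Kernel X X}

lemma measurable_stepExp {f : X → ℝ≥0∞} (hf : Measurable f) : Measurable (stepExp κ f) :=
  hf.lintegral_kernel

lemma measurable_stepExp_iterate {f : X → ℝ≥0∞} (hf : Measurable f) (n : ℕ) :
    Measurable ((stepExp κ)^[n] f) := by
  induction n with
  | zero => exact hf
  | succ n ih => rw [Function.iterate_succ_apply']; exact measurable_stepExp ih

lemma stepExp_tsum_mul {f : ℕ → X → ℝ≥0∞} (hf : ∀ n, Measurable (f n)) (c : ℕ → ℝ≥0∞) (x : X) :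
    stepExp κ (fun y => ∑' n, c n * f n y) x = ∑' n, c n * stepExp κ (f n) x := by
  unfold stepExp
  rw [lintegral_tsum fun n => ((hf n).const_mul _).aemeasurable]
  exact tsum_congr fun n => lintegral_const_mul _ (hf n)

end stepExp

/-! ### The Markov property of the trajectory law. -/

section trajLaw

variable {ν : Measure A} [SFinite ν] {P : Kernel (S × A) S} [IsMarkovKernel P] {π : Policy S ν}
  {μ : Measure (S × A)}

instance [IsProbabilityMeasure μ] : IsProbabilityMeasure (trajLaw P π μ) := by
  unfold trajLaw; infer_instance

instance {ρ₀ : Measure S} [IsProbabilityMeasure ρ₀] : IsProbabilityMeasure (initLaw π ρ₀) := by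
  unfold initLaw; infer_instance

lemma map_eval_zero_trajLaw : (trajLaw P π μ).map (fun ω => ω 0) = μ := by
  unfold trajLaw Kernel.trajMeasure
  have h : (fun ω : ℕ → S × A => ω 0) =
      (fun h : (i : Finset.Iic 0) → S × A => h ⟨0, Finset.mem_Iic.2 le_rfl⟩) ∘
        Preorder.frestrictLe (π := fun _ => S × A) 0 := rfl
  rw [Measure.map_comp _ _ (by fun_prop), h,
    Kernel.map_comp_right _ (Preorder.measurable_frestrictLe 0) (by fun_prop),
    Kernel.traj_map_frestrictLe, Kernel.partialTraj_self, ← Measure.map_comp _ _ (by fun_prop),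
    Measure.id_comp, Measure.map_map (by fun_prop) (by fun_prop)]
  have : (fun h : (i : Finset.Iic 0) → S × A => h ⟨0, Finset.mem_Iic.2 le_rfl⟩) ∘
      (MeasurableEquiv.piUnique fun _ : Finset.Iic 0 => S × A).symm = id := by
    funext x
    exact (MeasurableEquiv.piUnique fun _ : Finset.Iic 0 => S × A).apply_symm_apply x
  exact (congrArg (fun f => Measure.map f μ) this).trans Measure.map_id

/-- The transition kernel reads only the last coordinate of the history, so disintegrating the joint
law of the history and the next coordinate leaves a function of the state and action at time `n`. -/
lemma lintegral_trajLaw_succ [IsProbabilityMeasure μ] {f : S × A → ℝ≥0∞}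
    (hf : Measurable f) (n : ℕ) :
    ∫⁻ ω, f (ω (n + 1)) ∂trajLaw P π μ
      = ∫⁻ ω, stepExp (stepKernel P π) f (ω n) ∂trajLaw P π μ := by
  have key := Kernel.map_frestrictLe_trajMeasure_compProd_eq_map_trajMeasure
    (X := fun _ => S × A) (μ₀ := μ) (κ := fun n => (stepKernel P π).comap
      (fun h : (i : Finset.Iic n) → S × A => h ⟨n, Finset.mem_Iic.2 le_rfl⟩)
      (measurable_pi_apply _)) (a := n)
  have h2 : ∫⁻ z, f z.2 ∂((trajLaw P π μ).map
      (fun x => (Preorder.frestrictLe (π := fun _ => S × A) n x, x (n + 1))))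
      = ∫⁻ ω, f (ω (n + 1)) ∂trajLaw P π μ :=
    lintegral_map (by fun_prop)
      ((Preorder.measurable_frestrictLe n).prodMk (measurable_pi_apply _))
  rw [← h2]
  have hf2 : Measurable fun z : ((i : Finset.Iic n) → S × A) × S × A => f z.2 :=
    hf.comp measurable_snd
  unfold trajLaw
  rw [← key, Measure.lintegral_compProd hf2, lintegral_map _ (Preorder.measurable_frestrictLe n)]
  · rfl
  · exact Measurable.lintegral_kernel_prod_right' hf2

lemma lintegral_trajLaw_add [IsProbabilityMeasure μ] {f : S × A → ℝ≥0∞}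
    (hf : Measurable f) (t n : ℕ) :
    ∫⁻ ω, f (ω (t + n)) ∂trajLaw P π μ
      = ∫⁻ ω, (stepExp (stepKernel P π))^[n] f (ω t) ∂trajLaw P π μ := by
  induction n generalizing f with
  | zero => rfl
  | succ n ih =>
    rw [← add_assoc, lintegral_trajLaw_succ hf, ih (measurable_stepExp hf),
      Function.iterate_succ_apply]

end trajLaw

/-! ### Discounted sums of extended-real rewards. -/

section expDiscountedSum

lemma toENNReal_coe_sub_coe (w : ℝ) (d : ℝ≥0∞) :
    ((w : EReal) - (d : EReal)).toENNReal = ENNReal.ofReal w - d := by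
  rw [EReal.toENNReal_sub (EReal.coe_ennreal_nonneg d)]
  simp

lemma toENNReal_neg_coe_sub_coe (w : ℝ) (d : ℝ≥0∞) :
    (-((w : EReal) - (d : EReal))).toENNReal
      = (d + ENNReal.ofReal (-w)) - ENNReal.ofReal w := by
  induction d with
  | top => simp
  | coe d =>
    have e : ((d : ℝ≥0∞) : EReal) = ((d : ℝ) : EReal) := rfl
    rw [e, ← ENNReal.ofReal_coe_nnreal (p := d), ← ENNReal.ofReal_toReal
      (a := (ENNReal.ofReal d) + ENNReal.ofReal (-w)) (by simp), ← EReal.coe_sub, ← EReal.coe_neg,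
      EReal.real_coe_toENNReal, ENNReal.toReal_add (by simp) (by simp),
      ENNReal.toReal_ofReal d.coe_nonneg]
    rcases le_total 0 w with h | h
    · rw [ENNReal.ofReal_of_nonpos (by linarith : -w ≤ 0), ENNReal.toReal_zero, add_zero,
        ← ENNReal.ofReal_sub _ h]
      congr 1; ring
    · rw [ENNReal.ofReal_of_nonpos h, ENNReal.toReal_ofReal (by linarith), tsub_zero]
      congr 1; ring

/-- The positive and negative parts of `w - d`. -/
lemma toENNReal_parts (w : ℝ) (d : ℝ≥0∞) :
    ((w : EReal) - (d : EReal)).toENNReal + d + ENNReal.ofReal (-w)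
      = (-((w : EReal) - (d : EReal))).toENNReal + ENNReal.ofReal w := by
  rw [toENNReal_coe_sub_coe, toENNReal_neg_coe_sub_coe]
  rcases le_total 0 w with h | h
  · rw [ENNReal.ofReal_of_nonpos (by linarith : -w ≤ 0), add_zero, add_zero,
      tsub_add_eq_max, tsub_add_eq_max, max_comm]
  · rw [ENNReal.ofReal_of_nonpos h]; simp

/-- Identities between differences are checked additively in `ℝ≥0∞`, where `d` may be infinite. As
`p` is finite, `d = ⊤` forces `n = ⊤`, and both sides are `⊥`. -/
lemma coe_sub_coe_of_parts {p n d : ℝ≥0∞} {w₁ w₂ : ℝ} (h₁ : 0 ≤ w₁) (h₂ : 0 ≤ w₂) (hp : p ≠ ⊤)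
    (h : p + d + ENNReal.ofReal w₂ = n + ENNReal.ofReal w₁) :
    (p : EReal) - (n : EReal) = ((w₁ - w₂ : ℝ) : EReal) - (d : EReal) := by
  lift p to NNReal using hp
  induction d with
  | top =>
    have : n = ⊤ := by
      by_contra hn
      have : n + ENNReal.ofReal w₁ ≠ ⊤ := by simp [hn]
      exact this (by rw [← h]; simp)
    subst this
    simp
  | coe d =>
    have hn : n ≠ ⊤ := by
      rintro rfl
      have : (p : ℝ≥0∞) + d + ENNReal.ofReal w₂ ≠ ⊤ := by simp
      exact this (by rw [h]; simp)
    lift n to NNReal using hn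
    have h' := congrArg ENNReal.toReal h
    rw [ENNReal.toReal_add (by simp) (by simp), ENNReal.toReal_add (by simp) (by simp),
      ENNReal.toReal_add (by simp) (by simp), ENNReal.toReal_ofReal h₁,
      ENNReal.toReal_ofReal h₂] at h'
    simp only [ENNReal.coe_toReal] at h'
    have e : ∀ x : NNReal, (((x : ℝ≥0∞)) : EReal) = ((x : ℝ) : EReal) := fun x => rfl
    rw [e, e, e, ← EReal.coe_sub, ← EReal.coe_sub]
    congr 1
    linarith

lemma summable_geometric_shift_mul {γ : ℝ} (hγ0 : 0 ≤ γ) (hγ1 : γ < 1) (k : ℕ) {b : ℕ → ℝ} {C : ℝ}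
    (hb : ∀ l, |b l| ≤ C) : Summable fun l => γ ^ (k + l) * b l := by
  have h : Summable fun l : ℕ => γ ^ (k + l) * C := by
    simp_rw [pow_add, mul_assoc]
    exact ((summable_geometric_of_lt_one hγ0 hγ1).mul_right C).mul_left _
  refine Summable.of_norm_bounded h fun l => ?_
  rw [Real.norm_eq_abs, abs_mul, abs_of_nonneg (pow_nonneg hγ0 _)]
  exact mul_le_mul_of_nonneg_left (hb l) (pow_nonneg hγ0 _)

/-- The expected discounted sum of `w - d`, for a bounded `w` and a nonnegative `d`, splits. -/
lemma expDiscountedSum_sub {M : Measure (ℕ → S × A)} [IsProbabilityMeasure M] {γ : ℝ}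
    (hγ0 : 0 ≤ γ) (hγ1 : γ < 1) (k : ℕ) {g : S × A → EReal} {w : S × A → ℝ} {d : S × A → ℝ≥0∞}
    (hw : Measurable w) {C : ℝ} (hC : ∀ x, |w x| ≤ C) (hd : Measurable d)
    (hg : ∀ x, g x = (w x : EReal) - (d x : EReal)) :
    expDiscountedSum M γ k g
      = ((∑' l : ℕ, γ ^ (k + l) * ∫ ω, w (ω (k + l)) ∂M : ℝ) : EReal)
        - ((∑' l : ℕ, ENNReal.ofReal (γ ^ (k + l)) * ∫⁻ ω, d (ω (k + l)) ∂M : ℝ≥0∞) : EReal) := by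
  have hgp : Measurable fun x => (g x).toENNReal := by
    simp_rw [hg, toENNReal_coe_sub_coe]; fun_prop
  have hgn : Measurable fun x => (-g x).toENNReal := by
    simp_rw [hg, toENNReal_neg_coe_sub_coe]; fun_prop
  have hint : ∀ (v : S × A → ℝ) (n : ℕ), Measurable v → (∀ x, |v x| ≤ C) →
      Integrable (fun ω : ℕ → S × A => v (ω n)) M := fun v n hv hvC =>
    Integrable.of_bound (hv.comp (measurable_pi_apply n)).aestronglyMeasurable C
      (ae_of_all _ fun ω => hvC _)
  -- Used for `w` and for `-w`, to evaluate the discounted sums of the positive and negative parts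
  -- of `w`.
  have hpos : ∀ v : S × A → ℝ, Measurable v → (∀ x, |v x| ≤ C) →
      (Summable fun l => γ ^ (k + l) * ∫ ω, max (v (ω (k + l))) 0 ∂M) ∧
      ∑' l, ENNReal.ofReal (γ ^ (k + l)) * ∫⁻ ω, ENNReal.ofReal (v (ω (k + l))) ∂M
        = ENNReal.ofReal (∑' l, γ ^ (k + l) * ∫ ω, max (v (ω (k + l))) 0 ∂M) := by
    intro v hv hvC
    have hb : ∀ x, |max (v x) 0| ≤ C := fun x => by
      rw [abs_of_nonneg (le_max_right _ _)]
      exact max_le ((le_abs_self _).trans (hvC x)) ((abs_nonneg _).trans (hvC x))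
    have hs := summable_geometric_shift_mul hγ0 hγ1 k
      (b := fun l => ∫ ω, max (v (ω (k + l))) 0 ∂M) (C := C) (fun l => by
        simpa using norm_integral_le_of_norm_le_const (μ := M)
          (f := fun ω : ℕ → S × A => max (v (ω (k + l))) 0) (ae_of_all _ fun ω => hb (ω (k + l))))
    have h0 : ∀ l, 0 ≤ ∫ ω, max (v (ω (k + l))) 0 ∂M := fun l =>
      integral_nonneg fun ω => le_max_right _ _
    refine ⟨hs, ?_⟩
    rw [ENNReal.ofReal_tsum_of_nonneg (fun l => mul_nonneg (pow_nonneg hγ0 _) (h0 l)) hs]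
    refine tsum_congr fun l => ?_
    rw [ENNReal.ofReal_mul (pow_nonneg hγ0 _), ofReal_integral_eq_lintegral_ofReal
      (hint (fun x => max (v x) 0) _ (hv.max measurable_const) hb)
      (ae_of_all _ fun ω => le_max_right _ _)]
    simp
  obtain ⟨hs1, hp1⟩ := hpos w hw hC
  obtain ⟨hs2, hp2⟩ := hpos (fun x => -w x) hw.neg (fun x => by rw [abs_neg]; exact hC x)
  have hsplit : (∑' l : ℕ, γ ^ (k + l) * ∫ ω, w (ω (k + l)) ∂M)
      = (∑' l, γ ^ (k + l) * ∫ ω, max (w (ω (k + l))) 0 ∂M)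
        - ∑' l, γ ^ (k + l) * ∫ ω, max (-w (ω (k + l))) 0 ∂M := by
    rw [← hs1.tsum_sub hs2]
    refine tsum_congr fun l => ?_
    rw [← mul_sub, ← integral_sub (hint w _ hw hC).pos_part (hint w _ hw hC).neg_part]
    congr 2 with ω
    rcases le_total 0 (w (ω (k + l))) with h | h
    · rw [max_eq_left h, max_eq_right (by linarith)]; ring
    · rw [max_eq_right h, max_eq_left (by linarith)]; ring
  have htsum : ∀ f : S × A → ℝ≥0∞, Measurable f →
      ∫⁻ ω, ∑' l : ℕ, ENNReal.ofReal (γ ^ (k + l)) * f (ω (k + l)) ∂M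
        = ∑' l : ℕ, ENNReal.ofReal (γ ^ (k + l)) * ∫⁻ ω, f (ω (k + l)) ∂M := fun f hf => by
    have hfl : ∀ l, Measurable fun ω : ℕ → S × A => f (ω (k + l)) :=
      fun l => hf.comp (measurable_pi_apply _)
    rw [lintegral_tsum fun l => ((hfl l).const_mul _).aemeasurable]
    exact tsum_congr fun l => lintegral_const_mul _ (hfl l)
  unfold expDiscountedSum
  rw [htsum _ hgp, htsum _ hgn, hsplit]
  have hle : ∀ x, (g x).toENNReal ≤ ENNReal.ofReal (w x) := fun x => by
    rw [hg, toENNReal_coe_sub_coe]; exact tsub_le_self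
  refine coe_sub_coe_of_parts
    (tsum_nonneg fun l => mul_nonneg (pow_nonneg hγ0 _) (integral_nonneg fun ω => le_max_right _ _))
    (tsum_nonneg fun l => mul_nonneg (pow_nonneg hγ0 _) (integral_nonneg fun ω => le_max_right _ _))
    ?_ ?_
  -- The positive part of `w - d` is at most that of `w`, whose discounted sum is finite.
  · refine ne_top_of_le_ne_top (hp1.trans_ne ENNReal.ofReal_ne_top) ?_
    gcongr
    exact hle _
  · rw [← hp1, ← hp2, ← ENNReal.tsum_add, ← ENNReal.tsum_add, ← ENNReal.tsum_add]
    refine tsum_congr fun l => ?_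
    rw [← mul_add, ← mul_add, ← mul_add]
    congr 1
    have hm : ∀ f : S × A → ℝ≥0∞, Measurable f →
        Measurable fun ω : ℕ → S × A => f (ω (k + l)) :=
      fun f hf => hf.comp (measurable_pi_apply _)
    rw [← lintegral_add_left (hm _ hgp),
      ← lintegral_add_left (hm (fun x => (g x).toENNReal + d x) (hgp.add hd)),
      ← lintegral_add_left (hm _ hgn)]
    refine lintegral_congr fun ω => ?_
    rw [hg, toENNReal_parts]

/-- Two convergent series that differ by a shift. It is applied with `b n` the mean of `V` at time
`n`. -/
lemma tsum_discounted_telescope {γ : ℝ} (hγ0 : 0 ≤ γ) (hγ1 : γ < 1) (k : ℕ) {b : ℕ → ℝ} {C : ℝ}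
    (hb : ∀ l, |b l| ≤ C) :
    ∑' l, γ ^ (k + l) * (b (k + l) - γ * b (k + l + 1)) = γ ^ k * b k := by
  have hs0 : Summable fun l => γ ^ (k + l) * b (k + l) :=
    summable_geometric_shift_mul hγ0 hγ1 k (b := fun l => b (k + l)) fun l => hb _
  have hs1 : Summable fun l => γ ^ (k + (l + 1)) * b (k + (l + 1)) :=
    (summable_nat_add_iff 1).2 hs0
  have : ∀ l, γ ^ (k + l) * (b (k + l) - γ * b (k + l + 1))
      = γ ^ (k + l) * b (k + l) - γ ^ (k + (l + 1)) * b (k + (l + 1)) := fun l => by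
    rw [← add_assoc, pow_succ]; ring
  simp_rw [this]
  rw [hs0.tsum_sub hs1, hs0.tsum_eq_zero_add]
  simp

end expDiscountedSum

/-! ### Relative entropy and the Gibbs variational identity. -/

section Gibbs

/-- The Bregman divergence of `x ↦ x log x` between `p` and `exp u`. -/
def entropyBregman (p u : ℝ) : ℝ := p * Real.log p - p * u - p + Real.exp u

/-- Scaling by `exp u` reduces to `x log x + 1 - x`, which is nonnegative and vanishes only at `1`.
The case `p = 0` is separate because the logarithm of the product does not split there. -/
lemma entropyBregman_eq_klFun (p u : ℝ) :
    entropyBregman p u = Real.exp u * InformationTheory.klFun (p * Real.exp (-u)) := by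
  unfold entropyBregman
  rw [InformationTheory.klFun_apply]
  have h : Real.exp u * Real.exp (-u) = 1 := by rw [← Real.exp_add]; simp
  rcases eq_or_ne p 0 with rfl | hp
  · simp
  · rw [Real.log_mul hp (Real.exp_pos _).ne', Real.log_exp]
    linear_combination (-(p * (Real.log p + -u)) + p) * h

lemma entropyBregman_nonneg {p : ℝ} (hp : 0 ≤ p) (u : ℝ) : 0 ≤ entropyBregman p u := by
  rw [entropyBregman_eq_klFun]
  exact mul_nonneg (Real.exp_pos _).le (InformationTheory.klFun_nonneg (by positivity))

lemma entropyBregman_eq_zero_iff {p : ℝ} (hp : 0 ≤ p) (u : ℝ) :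
    entropyBregman p u = 0 ↔ p = Real.exp u := by
  rw [entropyBregman_eq_klFun, mul_eq_zero_iff_left (Real.exp_pos _).ne',
    InformationTheory.klFun_eq_zero_iff (by positivity), Real.exp_neg, mul_inv_eq_one₀
      (Real.exp_pos _).ne']

/-- The relative entropy of the density `f` with respect to the density `exp u`. -/
def gibbsGap (ν : Measure A) (f u : A → ℝ) : ℝ≥0∞ :=
  ∫⁻ a, ENNReal.ofReal (entropyBregman (f a) (u a)) ∂ν

lemma measurable_entropyBregman {X : Type*} [MeasurableSpace X] {f u : X → ℝ} (hf : Measurable f)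
    (hu : Measurable u) : Measurable fun x => entropyBregman (f x) (u x) := by
  unfold entropyBregman; fun_prop

variable {ν : Measure A} {f u : A → ℝ}

lemma gibbsGap_eq_zero_iff (hf : Measurable f) (hu : Measurable u) (hf0 : ∀ a, 0 ≤ f a) :
    gibbsGap ν f u = 0 ↔ ∀ᵐ a ∂ν, f a = Real.exp (u a) := by
  unfold gibbsGap
  rw [lintegral_eq_zero_iff (measurable_entropyBregman hf hu).ennreal_ofReal]
  refine Filter.eventually_congr (ae_of_all _ fun a => ?_)
  simp only [Pi.zero_apply, ENNReal.ofReal_eq_zero]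
  rw [← entropyBregman_eq_zero_iff (hf0 a)]
  exact ⟨fun h => h.antisymm (entropyBregman_nonneg (hf0 a) _), fun h => h.le⟩

lemma integrable_of_lintegral_ofReal_eq_one (hf : Measurable f) (hf0 : ∀ a, 0 ≤ f a)
    (hf1 : ∫⁻ a, ENNReal.ofReal (f a) ∂ν = 1) : Integrable f ν ∧ ∫ a, f a ∂ν = 1 := by
  refine ⟨⟨hf.aestronglyMeasurable, ?_⟩, ?_⟩
  · rw [hasFiniteIntegral_iff_ofReal (ae_of_all _ hf0), hf1]; exact ENNReal.one_lt_top
  · rw [integral_eq_lintegral_of_nonneg_ae (ae_of_all _ hf0) hf.aestronglyMeasurable, hf1]; simp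

lemma integrable_exp_of_bound [IsFiniteMeasure ν] (hu : Measurable u) {C : ℝ}
    (hC : ∀ a, |u a| ≤ C) : Integrable (fun a => Real.exp (u a)) ν :=
  Integrable.of_bound (by fun_prop) (Real.exp C) (ae_of_all _ fun a => by
    rw [Real.norm_eq_abs, Real.abs_exp]
    exact Real.exp_le_exp.2 ((le_abs_self _).trans (hC a)))

/-- The Gibbs variational identity: the entropy of `f` is its cross entropy with respect to
`exp u` minus its relative entropy. -/
lemma diffEntropy_eq_sub_gibbsGap [IsFiniteMeasure ν] (hf : Measurable f) (hf0 : ∀ a, 0 ≤ f a)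
    (hf1 : ∫⁻ a, ENNReal.ofReal (f a) ∂ν = 1) (hu : Measurable u) {C : ℝ} (hC : ∀ a, |u a| ≤ C)
    (hu1 : ∫ a, Real.exp (u a) ∂ν = 1) :
    diffEntropy ν f = ((-∫ a, f a * u a ∂ν : ℝ) : EReal) - (gibbsGap ν f u : EReal) := by
  obtain ⟨hfi, hf1'⟩ := integrable_of_lintegral_ofReal_eq_one hf hf0 hf1
  have hfu : Integrable (fun a => f a * u a) ν :=
    hfi.mul_bdd (c := C) hu.aestronglyMeasurable (ae_of_all _ hC)
  have hexp := integrable_exp_of_bound (ν := ν) hu hC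
  -- Chosen so that `negMulLog f = w - entropyBregman f u` pointwise. It is integrable, and its
  -- integral is the cross entropy because `f` and `exp u` both have mass `1`.
  set w : A → ℝ := fun a => -(f a * u a) - f a + Real.exp (u a) with hw
  have hneg : Integrable (fun a => -(f a * u a)) ν := hfu.neg
  have hsub : Integrable (fun a => -(f a * u a) - f a) ν := hneg.sub hfi
  have hwi : Integrable w ν := hsub.add hexp
  have hwint : -∫ a, f a * u a ∂ν = ∫ a, max (w a) 0 ∂ν - ∫ a, max (-w a) 0 ∂ν := by
    rw [← integral_sub hwi.pos_part hwi.neg_part]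
    have : ∀ a, max (w a) 0 - max (-w a) 0 = w a := fun a => by
      rcases le_total 0 (w a) with h | h
      · rw [max_eq_left h, max_eq_right (by linarith)]; ring
      · rw [max_eq_right h, max_eq_left (by linarith)]; ring
    simp_rw [this, hw]
    rw [integral_add hsub hexp, integral_sub hneg hfi, hf1', hu1, integral_neg]
    ring
  have hparts : ∀ v : A → ℝ, Integrable v ν →
      ENNReal.ofReal (∫ a, max (v a) 0 ∂ν) = ∫⁻ a, ENNReal.ofReal (v a) ∂ν := fun v hv => by
    rw [ofReal_integral_eq_lintegral_ofReal hv.pos_part (ae_of_all _ fun a => le_max_right _ _)]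
    simp
  have hlog : Measurable fun a => Real.negMulLog (f a) :=
    Real.continuous_negMulLog.measurable.comp hf
  have hφ := measurable_entropyBregman hf hu
  unfold diffEntropy gibbsGap
  rw [hwint]
  refine coe_sub_coe_of_parts (integral_nonneg fun a => le_max_right _ _)
    (integral_nonneg fun a => le_max_right _ _) ?_ ?_
  -- From `1 - 1/x ≤ log x` one gets `-x log x ≤ 1`; since `ν` is finite, the positive part of the
  -- entropy is finite.
  · refine ne_top_of_le_ne_top (b := ∫⁻ _, ENNReal.ofReal 1 ∂ν) (by simp) ?_
    refine lintegral_mono fun a => ENNReal.ofReal_le_ofReal ?_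
    have := Real.one_sub_inv_le_log_of_pos (x := f a)
    rcases (hf0 a).eq_or_lt with h | h
    · simp [← h]
    · have h2 := mul_le_mul_of_nonneg_left (this h) h.le
      rw [mul_sub, mul_inv_cancel₀ h.ne'] at h2
      rw [Real.negMulLog]
      linarith
  · rw [hparts _ hwi, hparts (fun a => -w a) hwi.neg, ← lintegral_add_left hlog.ennreal_ofReal,
      ← lintegral_add_left (f := fun a => ENNReal.ofReal (Real.negMulLog (f a))
        + ENNReal.ofReal (entropyBregman (f a) (u a))) (hlog.ennreal_ofReal.add hφ.ennreal_ofReal),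
      ← lintegral_add_left (f := fun a => ENNReal.ofReal (-Real.negMulLog (f a)))
        hlog.neg.ennreal_ofReal]
    refine lintegral_congr fun a => ?_
    have h := toENNReal_parts (w a) (ENNReal.ofReal (entropyBregman (f a) (u a)))
    have hd : w a - entropyBregman (f a) (u a) = Real.negMulLog (f a) := by
      simp only [hw, entropyBregman, Real.negMulLog]; ring
    rw [EReal.coe_ennreal_ofReal, max_eq_left (entropyBregman_nonneg (hf0 a) _), ← EReal.coe_sub,
      ← EReal.coe_neg, hd] at h
    exact h

end Gibbs

/-! ### The soft Bellman operator and its fixed point. -/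

section SoftBellman

/-- The state-action value of receiving `r` and continuing with the state value `V`. -/
def qOf (P : Kernel (S × A) S) (r : S → A → ℝ) (γ : ℝ) (V : S → ℝ) (s : S) (a : A) : ℝ :=
  r s a + γ * ∫ s', V s' ∂P (s, a)

/-- The log-partition function `α log ∫ exp (q(s, a) / α) da`. -/
def softMax (ν : Measure A) (α : ℝ) (q : S → A → ℝ) (s : S) : ℝ :=
  α * Real.log (∫ a, Real.exp (q s a / α) ∂ν)

/-- `V` is a bounded measurable solution of the soft Bellman equation. -/
structure IsSoftValue (ν : Measure A) (P : Kernel (S × A) S) (r : S → A → ℝ) (γ α : ℝ)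
    (V : S → ℝ) : Prop where
  measurable : Measurable V
  bounded : ∃ C, ∀ s, |V s| ≤ C
  eq_softMax : ∀ s, V s = softMax ν α (qOf P r γ V) s

variable {ν : Measure A} [IsFiniteMeasure ν] {P : Kernel (S × A) S}
  {r : S → A → ℝ} {γ α : ℝ}

lemma measurable_qOf (hr : Measurable (Function.uncurry r)) {V : S → ℝ} (hV : Measurable V) :
    Measurable (Function.uncurry (qOf P r γ V)) := by
  have h : Measurable fun x : S × A => ∫ s', V s' ∂P x :=
    (hV.stronglyMeasurable.integral_kernel).measurable
  exact hr.add (h.const_mul γ)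

lemma abs_qOf_le [IsMarkovKernel P] {R C : ℝ} (hγ0 : 0 ≤ γ) (hR : ∀ s a, |r s a| ≤ R) {V : S → ℝ}
    (hC : ∀ s, |V s| ≤ C) (s : S) (a : A) : |qOf P r γ V s a| ≤ R + γ * C := by
  refine (abs_add_le _ _).trans (add_le_add (hR s a) ?_)
  rw [abs_mul, abs_of_nonneg hγ0]
  refine mul_le_mul_of_nonneg_left ?_ hγ0
  simpa using norm_integral_le_of_norm_le_const (μ := P (s, a)) (f := V) (ae_of_all _ hC)

lemma qOf_le_add [IsMarkovKernel P] {V V' : S → ℝ} (hγ0 : 0 ≤ γ) (hV : Measurable V)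
    (hV' : Measurable V')
    {C C' : ℝ} (hC : ∀ s, |V s| ≤ C) (hC' : ∀ s, |V' s| ≤ C') {c : ℝ} (h : ∀ s, V s ≤ V' s + c)
    (s : S)
    (a : A) : qOf P r γ V s a ≤ qOf P r γ V' s a + γ * c := by
  have hi : Integrable V (P (s, a)) :=
    Integrable.of_bound hV.aestronglyMeasurable C (ae_of_all _ hC)
  have hi' : Integrable V' (P (s, a)) :=
    Integrable.of_bound hV'.aestronglyMeasurable C' (ae_of_all _ hC')
  have : ∫ s', V s' ∂P (s, a) ≤ ∫ s', V' s' ∂P (s, a) + c := by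
    have h1 := integral_mono hi (hi'.add (integrable_const c)) h
    refine h1.trans (le_of_eq ?_)
    rw [integral_add' hi' (integrable_const c)]; simp
  unfold qOf
  nlinarith

lemma measurable_softMax {q : S → A → ℝ} (hq : Measurable (Function.uncurry q)) :
    Measurable (softMax ν α q) := by
  have h : Measurable fun x : S × A => Real.exp (q x.1 x.2 / α) :=
    Real.measurable_exp.comp (hq.div_const α)
  exact (Real.measurable_log.comp
    (h.stronglyMeasurable.integral_prod_right').measurable).const_mul α

lemma integrable_exp_div {q : A → ℝ} (hq : Measurable q) {C : ℝ} (hC : ∀ a, |q a| ≤ C) :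
    Integrable (fun a => Real.exp (q a / α)) ν :=
  integrable_exp_of_bound (hq.div_const α) (C := C / |α|) fun a => by
    rw [abs_div]; exact div_le_div_of_nonneg_right (hC a) (abs_nonneg α)

/-- The log-partition function is monotone and commutes with adding constants. This gives both the
contraction and, later, the comparison of `V` with `softV`. -/
lemma softMax_le_add {T : Type*} [NeZero ν] (hα : 0 < α) {q q' : T → A → ℝ} {s : T}
    (hq : Measurable (q s)) (hq' : Measurable (q' s)) {C C' : ℝ} (hC : ∀ a, |q s a| ≤ C)
    (hC' : ∀ a, |q' s a| ≤ C') {c : ℝ} (h : ∀ᵐ a ∂ν, q s a ≤ q' s a + c) :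
    softMax ν α q s ≤ softMax ν α q' s + c := by
  have hi := integrable_exp_div (ν := ν) (α := α) hq hC
  have hi' := integrable_exp_div (ν := ν) (α := α) hq' hC'
  have h1 : ∫ a, Real.exp (q s a / α) ∂ν ≤ Real.exp (c / α) * ∫ a, Real.exp (q' s a / α) ∂ν := by
    rw [← integral_const_mul]
    refine integral_mono_ae hi (hi'.const_mul _) ?_
    filter_upwards [h] with a ha
    rw [← Real.exp_add, ← add_div]
    exact Real.exp_le_exp.2 (div_le_div_of_nonneg_right (by linarith) hα.le)
  have h2 := Real.log_le_log (integral_exp_pos hi) h1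
  rw [Real.log_mul (Real.exp_pos _).ne' (integral_exp_pos hi').ne', Real.log_exp] at h2
  have h3 := mul_le_mul_of_nonneg_left h2 hα.le
  rw [mul_add, mul_div_cancel₀ _ hα.ne'] at h3
  unfold softMax
  linarith

lemma abs_softMax_sub_le {T : Type*} [NeZero ν] (hα : 0 < α) {q q' : T → A → ℝ} {s : T}
    (hq : Measurable (q s)) (hq' : Measurable (q' s)) {C C' : ℝ} (hC : ∀ a, |q s a| ≤ C)
    (hC' : ∀ a, |q' s a| ≤ C') {c : ℝ} (h : ∀ a, |q s a - q' s a| ≤ c) :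
    |softMax ν α q s - softMax ν α q' s| ≤ c := by
  have h1 := softMax_le_add (ν := ν) hα hq hq' hC hC' (c := c)
    (ae_of_all _ fun a => by linarith [(abs_le.1 (h a)).2])
  have h2 := softMax_le_add (ν := ν) hα hq' hq hC' hC (c := c)
    (ae_of_all _ fun a => by linarith [(abs_le.1 (h a)).1])
  exact abs_le.2 ⟨by linarith, by linarith⟩

/-- Comparison with `q = 0`, whose log-partition function depends only on the mass of `ν`. -/
lemma abs_softMax_qOf_le [NeZero ν] [IsMarkovKernel P] (hα : 0 < α) (hγ0 : 0 ≤ γ)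
    (hr : Measurable (Function.uncurry r))
    {R : ℝ} (hR : ∀ s a, |r s a| ≤ R) {V : S → ℝ} (hV : Measurable V) {C : ℝ}
    (hC : ∀ s, |V s| ≤ C) (s : S) :
    |softMax ν α (qOf P r γ V) s| ≤ |softMax ν α (fun _ _ => 0 : S → A → ℝ) s| + (R + γ * C) := by
  have h := abs_softMax_sub_le (ν := ν) hα (q := qOf P r γ V) (q' := fun _ _ => 0) (s := s)
    ((measurable_qOf hr hV).comp measurable_prodMk_left) measurable_const
    (abs_qOf_le hγ0 hR hC s) (C' := 0) (by simp) (c := R + γ * C)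
    (by simpa using abs_qOf_le hγ0 hR hC s)
  have := abs_sub_abs_le_abs_sub (softMax ν α (qOf P r γ V) s)
    (softMax ν α (fun _ _ => 0 : S → A → ℝ) s)
  linarith

lemma abs_softMax_qOf_sub_le [NeZero ν] [IsMarkovKernel P] (hα : 0 < α) (hγ0 : 0 ≤ γ)
    (hr : Measurable (Function.uncurry r)) {R : ℝ} (hR : ∀ s a, |r s a| ≤ R) {V V' : S → ℝ}
    (hV : Measurable V) (hV' : Measurable V') {C C' : ℝ} (hC : ∀ s, |V s| ≤ C)
    (hC' : ∀ s, |V' s| ≤ C') {c : ℝ} (h : ∀ s, |V s - V' s| ≤ c) (s : S) :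
    |softMax ν α (qOf P r γ V) s - softMax ν α (qOf P r γ V') s| ≤ γ * c := by
  refine abs_softMax_sub_le (ν := ν) hα (q := qOf P r γ V) (q' := qOf P r γ V')
    ((measurable_qOf hr hV).comp measurable_prodMk_left)
    ((measurable_qOf hr hV').comp measurable_prodMk_left) (abs_qOf_le hγ0 hR hC s)
    (abs_qOf_le hγ0 hR hC' s) fun a => ?_
  have h1 := qOf_le_add (P := P) (r := r) hγ0 hV hV' hC hC' (c := c)
    (fun s => by linarith [(abs_le.1 (h s)).2]) s a
  have h2 := qOf_le_add (P := P) (r := r) hγ0 hV' hV hC' hC (c := c)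
    (fun s => by linarith [(abs_le.1 (h s)).1]) s a
  exact abs_le.2 ⟨by linarith, by linarith⟩

/-- The soft Bellman operator has a bounded measurable fixed point. -/
theorem exists_isSoftValue [NeZero ν] [IsMarkovKernel P] (hα : 0 < α) (hγ0 : 0 ≤ γ) (hγ1 : γ < 1)
    (hr : Measurable (Function.uncurry r)) {R : ℝ} (hR0 : 0 ≤ R) (hR : ∀ s a, |r s a| ≤ R) :
    ∃ V, IsSoftValue ν P r γ α V := by
  let L : (S → ℝ) → S → ℝ := fun V => softMax ν α (qOf P r γ V)
  let U : ℕ → S → ℝ := fun n => L^[n] (fun _ => 0)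
  have hU : ∀ n, U (n + 1) = L (U n) := fun n => Function.iterate_succ_apply' _ _ _
  set K : ℝ := |α * Real.log (ν.real Set.univ)| + R with hK
  have hK0 : 0 ≤ K := add_nonneg (abs_nonneg _) hR0
  have h1γ : 0 < 1 - γ := by linarith
  -- The solution of `K + γ M = M`, so that the operator preserves the ball of radius `M`.
  set M : ℝ := K / (1 - γ) with hM
  have hM0 : 0 ≤ M := div_nonneg hK0 h1γ.le
  have hKM : K + γ * M = M := by rw [hM]; field_simp; ring
  have h0 : ∀ s, |softMax ν α (fun _ _ => 0 : S → A → ℝ) s| = |α * Real.log (ν.real Set.univ)| :=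
    fun s => by simp [softMax]
  have hL : ∀ V : S → ℝ, Measurable V → (∀ s, |V s| ≤ M) →
      Measurable (L V) ∧ ∀ s, |L V s| ≤ M := fun V hV hVM => by
    refine ⟨measurable_softMax (measurable_qOf hr hV), fun s => ?_⟩
    have h := abs_softMax_qOf_le (ν := ν) (P := P) hα hγ0 hr hR hV hVM s
    rw [h0, ← add_assoc, ← hK, hKM] at h
    exact h
  have hUm : ∀ n, Measurable (U n) ∧ ∀ s, |U n s| ≤ M := fun n => by
    induction n with
    | zero => exact ⟨measurable_const, fun s => by simpa [U] using hM0⟩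
    | succ n ih => rw [hU]; exact hL _ ih.1 ih.2
  have hUd : ∀ n s, |U n s - U (n + 1) s| ≤ M * γ ^ n := fun n => by
    induction n with
    | zero => intro s; simpa [U] using (hUm 1).2 s
    | succ n ih =>
      intro s
      have := abs_softMax_qOf_sub_le (ν := ν) (P := P) hα hγ0 hr hR (hUm n).1 (hUm (n + 1)).1
        (hUm n).2 (hUm (n + 1)).2 ih s
      rw [hU n, hU (n + 1)]
      refine this.trans (le_of_eq ?_)
      rw [pow_succ]; ring
  have hcauchy : ∀ s, CauchySeq fun n => U n s := fun s =>
    cauchySeq_of_le_geometric γ M hγ1 fun n => by rw [Real.dist_eq]; exact hUd n s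
  choose V hV using fun s => cauchySeq_tendsto_of_complete (hcauchy s)
  -- Working with pointwise limits of the iterates keeps the fixed point measurable.
  have hVm : Measurable V :=
    measurable_of_tendsto_metrizable (fun n => (hUm n).1) (tendsto_pi_nhds.2 hV)
  have hVM : ∀ s, |V s| ≤ M := fun s => le_of_tendsto (hV s).abs (.of_forall fun n => (hUm n).2 s)
  have hdist : ∀ n s, |U n s - V s| ≤ M * γ ^ n / (1 - γ) := fun n s => by
    rw [← Real.dist_eq]
    exact dist_le_of_le_geometric_of_tendsto γ M hγ1
      (fun n => by rw [Real.dist_eq]; exact hUd n s) (hV s) n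
  refine ⟨V, hVm, ⟨M, hVM⟩, fun s => ?_⟩
  refine tendsto_nhds_unique ((Filter.tendsto_add_atTop_iff_nat 1).2 (hV s)) ?_
  rw [tendsto_iff_dist_tendsto_zero]
  refine squeeze_zero (fun _ => dist_nonneg) (g := fun n => γ * (M * γ ^ n / (1 - γ)))
    (fun n => ?_) ?_
  · rw [Real.dist_eq, hU]
    exact abs_softMax_qOf_sub_le (ν := ν) (P := P) hα hγ0 hr hR (hUm n).1 hVm (hUm n).2 hVM
      (hdist n) s
  · have h := (((tendsto_pow_atTop_nhds_zero_of_lt_one hγ0 hγ1).const_mul M).div_const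
      (1 - γ)).const_mul γ
    simpa using h

end SoftBellman

/-! ### Marginal laws of states and actions. -/

section Marginals

lemma Policy.measurable_dens_apply {ν : Measure A} (π : Policy S ν) (s : S) :
    Measurable (π.dens s) :=
  π.measurable_dens.comp measurable_prodMk_left

variable {ν : Measure A} [SFinite ν] {P : Kernel (S × A) S} {π : Policy S ν}

lemma Policy.kernel_apply (π : Policy S ν) (s : S) :
    π.kernel s = ν.withDensity fun a => ENNReal.ofReal (π.dens s a) := by
  rw [Policy.kernel, Kernel.withDensity_apply _ π.measurable_dens.ennreal_ofReal,
    Kernel.const_apply]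

lemma Policy.lintegral_kernel (π : Policy S ν) (s : S) {f : A → ℝ≥0∞} (hf : Measurable f) :
    ∫⁻ a, f a ∂π.kernel s = ∫⁻ a, ENNReal.ofReal (π.dens s a) * f a ∂ν := by
  rw [Policy.kernel_apply,
    lintegral_withDensity_eq_lintegral_mul _ (π.measurable_dens_apply s).ennreal_ofReal hf]
  rfl

lemma Policy.integral_kernel (π : Policy S ν) (s : S) (f : A → ℝ) :
    ∫ a, f a ∂π.kernel s = ∫ a, π.dens s a * f a ∂ν := by
  rw [Policy.kernel_apply, integral_withDensity_eq_integral_toReal_smul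
    (π.measurable_dens_apply s).ennreal_ofReal (ae_of_all _ fun _ => ENNReal.ofReal_lt_top)]
  simp_rw [ENNReal.toReal_ofReal (π.nonneg s _), smul_eq_mul]

variable [IsMarkovKernel P] {μ : Measure (S × A)}

lemma lintegral_stepKernel {f : S × A → ℝ≥0∞} (hf : Measurable f) (x : S × A) :
    ∫⁻ y, f y ∂stepKernel P π x = ∫⁻ s, ∫⁻ a, f (s, a) ∂π.kernel s ∂P x := by
  rw [stepKernel, Kernel.lintegral_compProd _ _ _ hf]
  rfl

lemma stepExp_fst {f : S → ℝ≥0∞} (hf : Measurable f) (x : S × A) :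
    stepExp (stepKernel P π) (fun y => f y.1) x = ∫⁻ s, f s ∂P x := by
  have hf' : Measurable fun y : S × A => f y.1 := hf.comp measurable_fst
  rw [stepExp, lintegral_stepKernel hf']
  simp

/-- The law of the state and action at time `n`. -/
def stateActionLaw (P : Kernel (S × A) S) [IsMarkovKernel P] (π : Policy S ν)
    (μ : Measure (S × A)) (n : ℕ) : Measure (S × A) :=
  (trajLaw P π μ).map fun ω => ω n

instance [IsProbabilityMeasure μ] (n : ℕ) : IsProbabilityMeasure (stateActionLaw P π μ n) :=
  Measure.isProbabilityMeasure_map (measurable_pi_apply n).aemeasurable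

lemma stateActionLaw_zero : stateActionLaw P π μ 0 = μ := map_eval_zero_trajLaw

lemma lintegral_stateActionLaw {f : S × A → ℝ≥0∞} (hf : Measurable f) (n : ℕ) :
    ∫⁻ x, f x ∂stateActionLaw P π μ n = ∫⁻ ω, f (ω n) ∂trajLaw P π μ :=
  lintegral_map hf (measurable_pi_apply n)

lemma integral_stateActionLaw {f : S × A → ℝ} (hf : Measurable f) (n : ℕ) :
    ∫ x, f x ∂stateActionLaw P π μ n = ∫ ω, f (ω n) ∂trajLaw P π μ :=
  integral_map (measurable_pi_apply n).aemeasurable hf.aestronglyMeasurable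

lemma lintegral_stateActionLaw_add [IsProbabilityMeasure μ] {f : S × A → ℝ≥0∞} (hf : Measurable f)
    (t n : ℕ) : ∫⁻ x, f x ∂stateActionLaw P π μ (t + n)
      = ∫⁻ x, (stepExp (stepKernel P π))^[n] f x ∂stateActionLaw P π μ t := by
  rw [lintegral_stateActionLaw hf, lintegral_trajLaw_add hf,
    lintegral_stateActionLaw (measurable_stepExp_iterate hf n)]

lemma stateLaw_eq (ρ₀ : Measure S) (t : ℕ) :
    stateLaw P π ρ₀ t = (stateActionLaw P π (initLaw π ρ₀) t).map Prod.fst :=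
  (Measure.map_map measurable_fst (measurable_pi_apply t)).symm

/-- Under `μ`, the action is drawn from `π` given the state. -/
def FollowsPolicy (π : Policy S ν) (μ : Measure (S × A)) : Prop :=
  μ = (μ.map Prod.fst) ⊗ₘ π.kernel

lemma followsPolicy_initLaw (ρ₀ : Measure S) [IsProbabilityMeasure ρ₀] :
    FollowsPolicy π (initLaw π ρ₀) := by
  have h : (initLaw π ρ₀).map Prod.fst = ρ₀ := Measure.fst_compProd ρ₀ π.kernel
  rw [FollowsPolicy, h]
  rfl

/-- Each step ends by drawing the action from `π`, so only the initial pair can be off-policy. This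
covers trajectories that start at a prescribed action, as in the soft Q-function. -/
lemma followsPolicy_stateActionLaw_succ [IsProbabilityMeasure μ] (n : ℕ) :
    FollowsPolicy π (stateActionLaw P π μ (n + 1)) := by
  refine Measure.ext_of_lintegral _ fun f hf => ?_
  have hf' : Measurable fun s => ∫⁻ a, f (s, a) ∂π.kernel s := hf.lintegral_kernel_prod_right'
  have := Measure.isProbabilityMeasure_map (μ := stateActionLaw P π μ (n + 1))
    (measurable_fst (α := S) (β := A)).aemeasurable
  rw [Measure.lintegral_compProd hf, lintegral_map hf' measurable_fst,
    lintegral_stateActionLaw_add hf, lintegral_stateActionLaw_add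
      (f := fun x => ∫⁻ a, f (x.1, a) ∂π.kernel x.1) (hf'.comp measurable_fst)]
  refine lintegral_congr fun x => ?_
  change stepExp _ f x = stepExp _ _ x
  rw [stepExp_fst hf', stepExp, lintegral_stepKernel hf]

lemma FollowsPolicy.stateActionLaw [IsProbabilityMeasure μ] (h : FollowsPolicy π μ) (n : ℕ) :
    FollowsPolicy π (stateActionLaw P π μ n) := by
  cases n with
  | zero => rw [stateActionLaw_zero]; exact h
  | succ n => exact followsPolicy_stateActionLaw_succ n

lemma map_fst_stateActionLaw_succ [IsProbabilityMeasure μ] (n : ℕ) :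
    (stateActionLaw P π μ (n + 1)).map Prod.fst
      = (stateActionLaw P π μ n ⊗ₘ P).map Prod.snd := by
  refine Measure.ext_of_lintegral _ fun f hf => ?_
  rw [lintegral_map hf measurable_fst, lintegral_map hf measurable_snd,
    Measure.lintegral_compProd (f := fun x => f x.2) (hf.comp measurable_snd),
    lintegral_stateActionLaw_add (f := fun x => f x.1) (hf.comp measurable_fst)]
  exact lintegral_congr fun x => stepExp_fst hf x

lemma integral_fst_stateActionLaw_succ [IsProbabilityMeasure μ] {f : S → ℝ} (hf : Measurable f)
    {C : ℝ} (hC : ∀ s, |f s| ≤ C) (n : ℕ) :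
    ∫ x, f x.1 ∂stateActionLaw P π μ (n + 1)
      = ∫ x, ∫ s, f s ∂P x ∂stateActionLaw P π μ n := by
  have h := integral_map (μ := stateActionLaw P π μ (n + 1))
    (measurable_fst (α := S) (β := A)).aemeasurable hf.aestronglyMeasurable
  rw [← h, map_fst_stateActionLaw_succ, integral_map measurable_snd.aemeasurable
    hf.aestronglyMeasurable, Measure.integral_compProd]
  exact Integrable.of_bound (hf.comp measurable_snd).aestronglyMeasurable C
    (ae_of_all _ fun x => hC _)

/-- The tower property; it replaces `q(s, a)` by its mean under `π(· | s)` in expectations. -/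
lemma FollowsPolicy.integral_eq [IsProbabilityMeasure μ] (h : FollowsPolicy π μ)
    {f : S × A → ℝ} (hf : Measurable f) {C : ℝ} (hC : ∀ x, |f x| ≤ C) :
    ∫ x, f x ∂μ = ∫ x, ∫ a, f (x.1, a) ∂π.kernel x.1 ∂μ := by
  have := Measure.isProbabilityMeasure_map (μ := μ) (measurable_fst (α := S) (β := A)).aemeasurable
  have hm : Measurable fun s => ∫ a, f (s, a) ∂π.kernel s :=
    hf.stronglyMeasurable.integral_kernel_prod_right'.measurable
  have h1 := integral_map (μ := μ) (measurable_fst (α := S) (β := A)).aemeasurable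
    hm.aestronglyMeasurable
  rw [← h1]
  conv_lhs => rw [h]
  exact Measure.integral_compProd
    (Integrable.of_bound hf.aestronglyMeasurable C (ae_of_all _ hC))

end Marginals

/-! ### The regret decomposition of the objective and the soft Q-function. -/

section Regret

variable {ν : Measure A} {P : Kernel (S × A) S} {r : S → A → ℝ} {γ α : ℝ} {V : S → ℝ}

/-- The logarithm of the Gibbs density attached to the state value `V`. -/
def gibbsLog (P : Kernel (S × A) S) (r : S → A → ℝ) (γ α : ℝ) (V : S → ℝ) (s : S) (a : A) : ℝ :=
  (qOf P r γ V s a - V s) / α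

lemma measurable_gibbsLog (hr : Measurable (Function.uncurry r)) (hV : Measurable V) :
    Measurable (Function.uncurry (gibbsLog P r γ α V)) :=
  ((measurable_qOf hr hV).sub (hV.comp measurable_fst)).div_const α

lemma measurable_gibbsLog_apply (hr : Measurable (Function.uncurry r)) (hV : Measurable V) (s : S) :
    Measurable (gibbsLog P r γ α V s) :=
  (measurable_gibbsLog hr hV).comp measurable_prodMk_left

/-- The expected loss of `π` at `s`, in one step, with respect to the Gibbs policy of `V`. -/
def regret (P : Kernel (S × A) S) (r : S → A → ℝ) (γ α : ℝ) (V : S → ℝ) (π : Policy S ν) (s : S) :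
    ℝ≥0∞ :=
  ENNReal.ofReal α * gibbsGap ν (π.dens s) (gibbsLog P r γ α V s)

lemma measurable_regret [SFinite ν] (hr : Measurable (Function.uncurry r)) (hV : Measurable V)
    (π : Policy S ν) : Measurable (regret P r γ α V π) := by
  have h : Measurable fun x : S × A => ENNReal.ofReal
      (entropyBregman (π.dens x.1 x.2) (gibbsLog P r γ α V x.1 x.2)) :=
    (measurable_entropyBregman π.measurable_dens (measurable_gibbsLog hr hV)).ennreal_ofReal
  exact (h.lintegral_prod_right').const_mul _

lemma regret_eq_zero_iff (hα : 0 < α) (hr : Measurable (Function.uncurry r)) (hV : Measurable V)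
    (π : Policy S ν) (s : S) : regret P r γ α V π s = 0 ↔
      ∀ᵐ a ∂ν, π.dens s a = Real.exp (gibbsLog P r γ α V s a) := by
  rw [regret, mul_eq_zero, or_iff_right (by simpa using hα), gibbsGap_eq_zero_iff
    (π.measurable_dens_apply s) (measurable_gibbsLog_apply hr hV s)
    (π.nonneg s)]

variable [IsMarkovKernel P] {R : ℝ}

lemma IsSoftValue.exists_abs_qOf_le (hV : IsSoftValue ν P r γ α V) (hγ0 : 0 ≤ γ)
    (hR : ∀ s a, |r s a| ≤ R) : ∃ C, ∀ s a, |qOf P r γ V s a| ≤ C := by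
  obtain ⟨C, hC⟩ := hV.bounded
  exact ⟨_, abs_qOf_le hγ0 hR hC⟩

variable [IsFiniteMeasure ν]

/-- The Bellman equation says that `exp (V / α)` is the partition function of `q`. -/
lemma IsSoftValue.integral_exp_gibbsLog [NeZero ν] (hV : IsSoftValue ν P r γ α V) (hα : 0 < α)
    (hγ0 : 0 ≤ γ) (hr : Measurable (Function.uncurry r)) (hR : ∀ s a, |r s a| ≤ R) (s : S) :
    ∫ a, Real.exp (gibbsLog P r γ α V s a) ∂ν = 1 := by
  obtain ⟨C, hC⟩ := hV.exists_abs_qOf_le hγ0 hR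
  have hi := integrable_exp_div (ν := ν) (α := α)
    ((measurable_qOf (P := P) (γ := γ) hr hV.measurable).comp measurable_prodMk_left) (hC s)
  have hpos := integral_exp_pos hi
  have h1 : Real.exp (V s / α) = ∫ a, Real.exp (qOf P r γ V s a / α) ∂ν := by
    conv_lhs => rw [hV.eq_softMax s, softMax, mul_div_cancel_left₀ _ hα.ne']
    exact Real.exp_log hpos
  simp_rw [gibbsLog, sub_div, Real.exp_sub]
  rw [integral_div, h1]
  exact div_self hpos.ne'

/-- The soft reward is a bounded function minus the regret. -/
lemma IsSoftValue.softReward_eq [NeZero ν] (hV : IsSoftValue ν P r γ α V) (hα : 0 < α)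
    (hγ0 : 0 ≤ γ) (hr : Measurable (Function.uncurry r)) (hR : ∀ s a, |r s a| ≤ R)
    (π : Policy S ν) (x : S × A) :
    softReward r α π x
      = ((r x.1 x.2 - ∫ a, qOf P r γ V x.1 a ∂π.kernel x.1 + V x.1 : ℝ) : EReal)
        - (regret P r γ α V π x.1 : EReal) := by
  obtain ⟨C, hC⟩ := hV.exists_abs_qOf_le hγ0 hR
  obtain ⟨D, hD⟩ := hV.bounded
  have hq := (measurable_qOf (P := P) (γ := γ) hr hV.measurable).comp
    (measurable_prodMk_left (x := x.1))
  obtain ⟨hfi, hf1⟩ := integrable_of_lintegral_ofReal_eq_one (π.measurable_dens_apply x.1)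
    (π.nonneg x.1) (π.lintegral_eq_one x.1)
  have hent := diffEntropy_eq_sub_gibbsGap (ν := ν) (π.measurable_dens_apply x.1) (π.nonneg x.1)
    (π.lintegral_eq_one x.1) (u := gibbsLog P r γ α V x.1)
    (measurable_gibbsLog_apply hr hV.measurable x.1) (C := (C + D) / α)
    (fun a => by
      rw [gibbsLog, abs_div, abs_of_pos hα]
      exact div_le_div_of_nonneg_right ((abs_sub _ _).trans (add_le_add (hC _ _) (hD _))) hα.le)
    (hV.integral_exp_gibbsLog hα hγ0 hr hR x.1)
  have hcross : α * -∫ a, π.dens x.1 a * gibbsLog P r γ α V x.1 a ∂ν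
      = -∫ a, qOf P r γ V x.1 a ∂π.kernel x.1 + V x.1 := by
    have h1 : Integrable (fun a => π.dens x.1 a * qOf P r γ V x.1 a) ν :=
      hfi.mul_bdd (c := C) hq.aestronglyMeasurable (ae_of_all _ (hC x.1))
    have h2 : ∀ a, π.dens x.1 a * gibbsLog P r γ α V x.1 a
        = (π.dens x.1 a * qOf P r γ V x.1 a - π.dens x.1 a * V x.1) / α := fun a => by
      rw [gibbsLog]; ring
    simp_rw [h2]
    rw [integral_div, integral_sub h1 (hfi.mul_const _), integral_mul_const, hf1,
      π.integral_kernel]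
    field_simp
    ring
  rw [softReward, hent, regret]
  induction h : gibbsGap ν (π.dens x.1) (gibbsLog P r γ α V x.1) with
  -- Both sides are `⊥`, since `α > 0`.
  | top =>
    rw [ENNReal.mul_top (by simpa using hα)]
    simp [EReal.coe_mul_bot_of_pos hα]
  | coe d =>
    have e : ∀ d : NNReal, ((d : ℝ≥0∞) : EReal) = ((d : ℝ) : EReal) := fun d => rfl
    rw [EReal.coe_ennreal_mul, e, EReal.coe_ennreal_ofReal, max_eq_left hα.le, ← EReal.coe_sub,
      ← EReal.coe_mul, ← EReal.coe_mul, ← EReal.coe_add, ← EReal.coe_sub, mul_sub, hcross]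
    congr 1
    ring

/-- The expected discounted regret, from time `k` on, of trajectories that start at `x`. -/
def discountedRegret (P : Kernel (S × A) S) (r : S → A → ℝ) (γ α : ℝ) (V : S → ℝ)
    (π : Policy S ν) (k : ℕ) (x : S × A) : ℝ≥0∞ :=
  ∑' l : ℕ, ENNReal.ofReal (γ ^ (k + l)) *
    (stepExp (stepKernel P π))^[k + l] (fun y => regret P r γ α V π y.1) x

/-- On laws that follow `π`, the mean of `q(s_t, a_t)` equals that of `∫ q dπ(· | s_t)`. The bounded
part of the soft reward thus has mean `E V(s_t) - γ E V(s_{t+1})`, and its discounted sum collapses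
to the term at time `k`. -/
lemma expDiscountedSum_softReward [NeZero ν] (hV : IsSoftValue ν P r γ α V) (hα : 0 < α)
    (hγ0 : 0 ≤ γ) (hγ1 : γ < 1) (hr : Measurable (Function.uncurry r)) (hR : ∀ s a, |r s a| ≤ R)
    (π : Policy S ν) (μ : Measure (S × A)) [IsProbabilityMeasure μ] (k : ℕ)
    (hμ : ∀ l, FollowsPolicy π (stateActionLaw P π μ (k + l))) :
    expDiscountedSum (trajLaw P π μ) γ k (softReward r α π)
      = ((γ ^ k * ∫ x, V x.1 ∂stateActionLaw P π μ k : ℝ) : EReal)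
        - ((∑' l : ℕ, ENNReal.ofReal (γ ^ (k + l)) *
          ∫⁻ x, regret P r γ α V π x.1 ∂stateActionLaw P π μ (k + l) : ℝ≥0∞) : EReal) := by
  obtain ⟨C, hC⟩ := hV.exists_abs_qOf_le hγ0 hR
  obtain ⟨D, hD⟩ := hV.bounded
  have hVm := hV.measurable
  have hqm := measurable_qOf (P := P) (γ := γ) hr hVm
  have hEq : Measurable fun x : S × A => ∫ a, qOf P r γ V x.1 a ∂π.kernel x.1 :=
    (hqm.stronglyMeasurable.integral_kernel_prod_right'.measurable).comp measurable_fst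
  have hEqC : ∀ x : S × A, |∫ a, qOf P r γ V x.1 a ∂π.kernel x.1| ≤ C := fun x => by
    simpa using norm_integral_le_of_norm_le_const (μ := π.kernel x.1)
      (f := fun a => qOf P r γ V x.1 a) (ae_of_all _ (hC x.1))
  have hPV : Measurable fun x : S × A => ∫ s, V s ∂P x :=
    hVm.stronglyMeasurable.integral_kernel.measurable
  have hPVD : ∀ x : S × A, |∫ s, V s ∂P x| ≤ D := fun x => by
    simpa using norm_integral_le_of_norm_le_const (μ := P x) (f := V) (ae_of_all _ hD)
  have hwm : Measurable fun x : S × A =>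
      r x.1 x.2 - ∫ a, qOf P r γ V x.1 a ∂π.kernel x.1 + V x.1 :=
    (hr.sub hEq).add (hVm.comp measurable_fst)
  have hreg : Measurable fun x : S × A => regret P r γ α V π x.1 :=
    (measurable_regret hr hVm π).comp measurable_fst
  rw [expDiscountedSum_sub hγ0 hγ1 k hwm (C := R + C + D) (fun x => ?_) hreg
    (hV.softReward_eq hα hγ0 hr hR π)]
  · simp_rw [← lintegral_stateActionLaw hreg, ← integral_stateActionLaw hwm]
    have hb : ∀ l, |∫ x, V x.1 ∂stateActionLaw P π μ l| ≤ D := fun l => by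
      simpa using norm_integral_le_of_norm_le_const (μ := stateActionLaw P π μ l)
        (f := fun x => V x.1) (ae_of_all _ fun x => hD x.1)
    rw [← tsum_discounted_telescope hγ0 hγ1 k hb]
    congr 2
    refine tsum_congr fun l => ?_
    congr 1
    set M := stateActionLaw P π μ (k + l) with hM
    have hint : ∀ {f : S × A → ℝ}, Measurable f → ∀ {c : ℝ}, (∀ x, |f x| ≤ c) → Integrable f M :=
      by
      intro f hf c hc
      exact Integrable.of_bound hf.aestronglyMeasurable c (ae_of_all _ hc)
    have hri := hint (f := fun x => r x.1 x.2) hr fun x => hR _ _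
    have h1 := (hμ l).integral_eq hqm (C := C) fun x => hC x.1 x.2
    have h2 : ∫ x, Function.uncurry (qOf P r γ V) x ∂M
        = ∫ x, r x.1 x.2 ∂M + γ * ∫ x, ∫ s, V s ∂P x ∂M := by
      rw [← integral_const_mul, ← integral_add hri ((hint hPV hPVD).const_mul _)]
      rfl
    rw [integral_fst_stateActionLaw_succ hVm hD, integral_add
      (f := fun x : S × A => r x.1 x.2 - ∫ a, qOf P r γ V x.1 a ∂π.kernel x.1)
      (g := fun x => V x.1) (hri.sub (hint hEq hEqC))
      (hint (hVm.comp measurable_fst) fun x => hD _), integral_sub hri (hint hEq hEqC)]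
    simp only [Function.uncurry_apply_pair] at h1
    rw [← h1, h2]
    ring
  · have := abs_add_le (r x.1 x.2 - ∫ a, qOf P r γ V x.1 a ∂π.kernel x.1) (V x.1)
    have h3 := abs_sub (r x.1 x.2) (∫ a, qOf P r γ V x.1 a ∂π.kernel x.1)
    linarith [hR x.1 x.2, hEqC x, hD x.1]

/-- The soft Q-function of `π` is the solution of the soft Bellman equation minus the expected
discounted future regret of `π`. -/
theorem softQ_eq_sub_discountedRegret [NeZero ν] (hV : IsSoftValue ν P r γ α V) (hα : 0 < α)
    (hγ0 : 0 ≤ γ) (hγ1 : γ < 1) (hr : Measurable (Function.uncurry r)) (hR : ∀ s a, |r s a| ≤ R)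
    (π : Policy S ν) (s : S) (a : A) :
    softQ P r γ α π s a
      = (qOf P r γ V s a : EReal) - (discountedRegret P r γ α V π 1 (s, a) : EReal) := by
  obtain ⟨D, hD⟩ := hV.bounded
  have hVm := hV.measurable
  have hreg : Measurable fun x : S × A => regret P r γ α V π x.1 :=
    (measurable_regret hr hVm π).comp measurable_fst
  have hPV : Measurable fun x : S × A => ∫ s, V s ∂P x :=
    hVm.stronglyMeasurable.integral_kernel.measurable
  have h1 : ∫ x, V x.1 ∂stateActionLaw P π (Measure.dirac (s, a)) 1 = ∫ s', V s' ∂P (s, a) := by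
    rw [integral_fst_stateActionLaw_succ hVm hD 0, stateActionLaw_zero,
      integral_dirac' _ _ hPV.stronglyMeasurable]
  have h2 : ∀ l, ∫⁻ x, regret P r γ α V π x.1 ∂stateActionLaw P π (Measure.dirac (s, a)) l
      = (stepExp (stepKernel P π))^[l] (fun y => regret P r γ α V π y.1) (s, a) := fun l => by
    have h := lintegral_stateActionLaw_add (P := P) (π := π) (μ := Measure.dirac (s, a)) hreg 0 l
    rw [zero_add, stateActionLaw_zero, lintegral_dirac' _ (measurable_stepExp_iterate hreg l)] at h
    exact h
  rw [softQ, expDiscountedSum_softReward hV hα hγ0 hγ1 hr hR π _ 1 fun l => by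
    rw [add_comm]; exact followsPolicy_stateActionLaw_succ l]
  simp_rw [h1, h2, pow_one]
  rw [sub_eq_add_neg, ← add_assoc, ← EReal.coe_add, ← sub_eq_add_neg]
  rfl

/-- The maximum entropy objective of `π` is the mean solution of the soft Bellman equation minus
the expected discounted regret of `π`. -/
theorem objective_eq_sub_regret [NeZero ν] (hV : IsSoftValue ν P r γ α V) (hα : 0 < α)
    (hγ0 : 0 ≤ γ) (hγ1 : γ < 1) (hr : Measurable (Function.uncurry r)) (hR : ∀ s a, |r s a| ≤ R)
    (π : Policy S ν) (ρ₀ : Measure S) [IsProbabilityMeasure ρ₀] :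
    objective P r γ α ρ₀ π
      = ((∫ s, V s ∂ρ₀ : ℝ) : EReal) - ((∑' l : ℕ, ENNReal.ofReal (γ ^ l) *
          ∫⁻ x, regret P r γ α V π x.1 ∂stateActionLaw P π (initLaw π ρ₀) l : ℝ≥0∞) : EReal) := by
  have hfst : (initLaw π ρ₀).map Prod.fst = ρ₀ := Measure.fst_compProd ρ₀ π.kernel
  have h1 := integral_map (μ := initLaw π ρ₀) (measurable_fst (α := S) (β := A)).aemeasurable
    hV.measurable.aestronglyMeasurable
  rw [hfst] at h1
  rw [objective, expDiscountedSum_softReward hV hα hγ0 hγ1 hr hR π _ 0 fun l =>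
    (followsPolicy_initLaw ρ₀).stateActionLaw _]
  simp_rw [zero_add, pow_zero, one_mul, stateActionLaw_zero, h1]

end Regret

/-! ### Zero regret, optimality and energy-based policies. -/

section Optimality

variable {ν : Measure A} {P : Kernel (S × A) S} {r : S → A → ℝ} {γ α : ℝ}
  {V : S → ℝ} {R : ℝ} [IsFiniteMeasure ν] {π : Policy S ν}

lemma measurable_discountedRegret (hr : Measurable (Function.uncurry r)) (hV : Measurable V)
    (π : Policy S ν) (k : ℕ) : Measurable (discountedRegret P r γ α V π k) :=
  Measurable.tsum fun _ => (measurable_stepExp_iterate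
    ((measurable_regret hr hV π).comp measurable_fst) _).const_mul _

/-- A shift of the series by one step; this recursion supplies the factor `γ` in the final
contraction. -/
lemma discountedRegret_one_eq (hγ0 : 0 ≤ γ) (hr : Measurable (Function.uncurry r))
    (hV : Measurable V) (π : Policy S ν) (x : S × A) :
    discountedRegret P r γ α V π 1 x = ENNReal.ofReal γ * stepExp (stepKernel P π)
      (fun y => regret P r γ α V π y.1 + discountedRegret P r γ α V π 1 y) x := by
  have hreg : Measurable fun x : S × A => regret P r γ α V π x.1 :=
    (measurable_regret hr hV π).comp measurable_fst
  have h0 : (fun y => regret P r γ α V π y.1 + discountedRegret P r γ α V π 1 y)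
      = fun y => ∑' l : ℕ, ENNReal.ofReal (γ ^ l) *
        (stepExp (stepKernel P π))^[l] (fun y => regret P r γ α V π y.1) y := by
    funext y
    rw [tsum_eq_zero_add' ENNReal.summable]
    simp [discountedRegret, add_comm]
  rw [h0, stepExp_tsum_mul (measurable_stepExp_iterate hreg), ← ENNReal.tsum_mul_left]
  refine tsum_congr fun l => ?_
  rw [add_comm, pow_succ', ENNReal.ofReal_mul hγ0, mul_assoc, Function.iterate_succ_apply']

variable [IsMarkovKernel P]

lemma discountedRegret_eq_zero (h : ∀ s, regret P r γ α V π s = 0) (k : ℕ) (x : S × A) :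
    discountedRegret P r γ α V π k x = 0 := by
  have h1 : (fun y : S × A => regret P r γ α V π y.1) = fun _ => 0 := funext fun y => h y.1
  have h2 : stepExp (stepKernel P π) (fun _ => 0) = fun _ => 0 := by
    funext y; simp [stepExp]
  simp [discountedRegret, h1, Function.iterate_fixed h2]

lemma coe_eq_zero_of_le_sub {v : ℝ} {d : ℝ≥0∞} (h : (v : EReal) ≤ (v : EReal) - (d : EReal)) :
    d = 0 := by
  induction d with
  | top => simp at h
  | coe d =>
    have e : ((d : ℝ≥0∞) : EReal) = ((d : ℝ) : EReal) := rfl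
    rw [e, ← EReal.coe_sub, EReal.coe_le_coe_iff] at h
    have : d ≤ 0 := by rw [← NNReal.coe_le_coe]; simpa using h
    simpa using this

lemma coe_sub_coe_le (v : ℝ) (d : ℝ≥0∞) : (v : EReal) - (d : EReal) ≤ v := by
  have := EReal.sub_le_sub (le_refl (v : EReal)) (EReal.coe_ennreal_nonneg d)
  simpa using this

lemma softV_eq_of_ae (hV : IsSoftValue ν P r γ α V) {s : S}
    (h : ∀ᵐ a ∂ν, softQ P r γ α π s a = (qOf P r γ V s a : EReal)) :
    softV P r γ α π s = V s := by
  rw [hV.eq_softMax s, softV, softMax, integral_congr_ae]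
  filter_upwards [h] with a ha
  rw [ha, EReal.toReal_coe]

lemma isEnergyBasedAt_of_ae (hV : IsSoftValue ν P r γ α V) (hα : 0 < α)
    (hγ0 : 0 ≤ γ) (hr : Measurable (Function.uncurry r)) (hR : ∀ s a, |r s a| ≤ R) {s : S}
    (h : ∀ᵐ a ∂ν, softQ P r γ α π s a = (qOf P r γ V s a : EReal))
    (hs : regret P r γ α V π s = 0) : IsEnergyBasedAt P r γ α π s := by
  obtain ⟨C, hC⟩ := hV.exists_abs_qOf_le hγ0 hR
  refine ⟨?_, ?_, ?_⟩
  · filter_upwards [h] with a ha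
    rw [ha]; simp
  · have hi := integrable_exp_div (ν := ν) (α := α)
      ((measurable_qOf (P := P) (γ := γ) hr hV.measurable).comp measurable_prodMk_left) (hC s)
    refine hi.congr ?_
    filter_upwards [h] with a ha
    rw [ha]; simp
  · filter_upwards [h, (regret_eq_zero_iff hα hr hV.measurable π s).1 hs] with a ha hp
    rw [hp, softV_eq_of_ae hV h, ha, EReal.toReal_coe, gibbsLog]

variable [NeZero ν]

/-- The policy with the Gibbs densities attached to a solution of the soft Bellman equation. -/
def gibbsPolicy (hV : IsSoftValue ν P r γ α V) (hα : 0 < α) (hγ0 : 0 ≤ γ)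
    (hr : Measurable (Function.uncurry r)) (hR : ∀ s a, |r s a| ≤ R) : Policy S ν where
  dens s a := Real.exp (gibbsLog P r γ α V s a)
  measurable_dens := Real.measurable_exp.comp (measurable_gibbsLog hr hV.measurable)
  nonneg s a := (Real.exp_pos _).le
  lintegral_eq_one s := by
    have h1 := hV.integral_exp_gibbsLog hα hγ0 hr hR s
    have hi : Integrable (fun a => Real.exp (gibbsLog P r γ α V s a)) ν := by
      by_contra h
      rw [integral_undef h] at h1
      exact zero_ne_one h1
    rw [← ofReal_integral_eq_lintegral_ofReal hi (ae_of_all _ fun _ => (Real.exp_pos _).le), h1,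
      ENNReal.ofReal_one]

lemma regret_gibbsPolicy (hV : IsSoftValue ν P r γ α V) (hα : 0 < α) (hγ0 : 0 ≤ γ)
    (hr : Measurable (Function.uncurry r)) (hR : ∀ s a, |r s a| ≤ R) (s : S) :
    regret P r γ α V (gibbsPolicy hV hα hγ0 hr hR) s = 0 :=
  (regret_eq_zero_iff hα hr hV.measurable _ s).2 (ae_of_all _ fun _ => rfl)

lemma objective_le (hV : IsSoftValue ν P r γ α V) (hα : 0 < α)
    (hγ0 : 0 ≤ γ) (hγ1 : γ < 1) (hr : Measurable (Function.uncurry r)) (hR : ∀ s a, |r s a| ≤ R)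
    (π : Policy S ν) (ρ₀ : Measure S) [IsProbabilityMeasure ρ₀] :
    objective P r γ α ρ₀ π ≤ ((∫ s, V s ∂ρ₀ : ℝ) : EReal) := by
  rw [objective_eq_sub_regret hV hα hγ0 hγ1 hr hR]
  exact coe_sub_coe_le _ _

lemma objective_eq_of_regret_eq_zero (hV : IsSoftValue ν P r γ α V) (hα : 0 < α)
    (hγ0 : 0 ≤ γ) (hγ1 : γ < 1) (hr : Measurable (Function.uncurry r)) (hR : ∀ s a, |r s a| ≤ R)
    (h : ∀ s, regret P r γ α V π s = 0) (ρ₀ : Measure S) [IsProbabilityMeasure ρ₀] :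
    objective P r γ α ρ₀ π = ((∫ s, V s ∂ρ₀ : ℝ) : EReal) := by
  rw [objective_eq_sub_regret hV hα hγ0 hγ1 hr hR]
  simp [h]

lemma isMaxEntOptimal_of_regret_eq_zero (hV : IsSoftValue ν P r γ α V) (hα : 0 < α)
    (hγ0 : 0 ≤ γ) (hγ1 : γ < 1) (hr : Measurable (Function.uncurry r)) (hR : ∀ s a, |r s a| ≤ R)
    (h : ∀ s, regret P r γ α V π s = 0) (ρ₀ : Measure S) [IsProbabilityMeasure ρ₀] :
    IsMaxEntOptimal P r γ α ρ₀ π := fun π' => by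
  rw [objective_eq_of_regret_eq_zero hV hα hγ0 hγ1 hr hR h]
  exact objective_le hV hα hγ0 hγ1 hr hR π' ρ₀

/-- An optimal policy has no expected regret at the times that carry weight. -/
lemma IsMaxEntOptimal.lintegral_regret_eq_zero {ρ₀ : Measure S} [IsProbabilityMeasure ρ₀]
    (h : IsMaxEntOptimal P r γ α ρ₀ π) (hV : IsSoftValue ν P r γ α V) (hα : 0 < α)
    (hγ0 : 0 ≤ γ) (hγ1 : γ < 1) (hr : Measurable (Function.uncurry r)) (hR : ∀ s a, |r s a| ≤ R)
    {t : ℕ} (ht : 0 < γ ^ t) :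
    ∫⁻ x, regret P r γ α V π x.1 ∂stateActionLaw P π (initLaw π ρ₀) t = 0 := by
  -- The Gibbs policy attains `∫ V dρ₀`, so the total discounted regret of `π` vanishes, hence each
  -- of its terms.
  have h1 := h (gibbsPolicy hV hα hγ0 hr hR)
  rw [objective_eq_of_regret_eq_zero hV hα hγ0 hγ1 hr hR (regret_gibbsPolicy hV hα hγ0 hr hR),
    objective_eq_sub_regret hV hα hγ0 hγ1 hr hR] at h1
  have h2 := ENNReal.tsum_eq_zero.1 (coe_eq_zero_of_le_sub h1) t
  exact (mul_eq_zero.1 h2).resolve_left (by simpa using ht)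

lemma softQ_eq_qOf (hV : IsSoftValue ν P r γ α V) (hα : 0 < α)
    (hγ0 : 0 ≤ γ) (hγ1 : γ < 1) (hr : Measurable (Function.uncurry r)) (hR : ∀ s a, |r s a| ≤ R)
    {s : S} {a : A} (h : discountedRegret P r γ α V π 1 (s, a) = 0) :
    softQ P r γ α π s a = (qOf P r γ V s a : EReal) := by
  rw [softQ_eq_sub_discountedRegret hV hα hγ0 hγ1 hr hR, h]
  simp

/-- Starting from a point mass turns an almost-everywhere statement into one at `s`. Time `0` has
weight `1` even when `γ = 0`. -/
lemma regret_eq_zero_of_optimal (hV : IsSoftValue ν P r γ α V) (hα : 0 < α)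
    (hγ0 : 0 ≤ γ) (hγ1 : γ < 1) (hr : Measurable (Function.uncurry r)) (hR : ∀ s a, |r s a| ≤ R)
    {s : S} (h : IsMaxEntOptimal P r γ α (Measure.dirac s) π) : regret P r γ α V π s = 0 := by
  have hreg := measurable_regret (P := P) (γ := γ) (α := α) hr hV.measurable π
  have h1 := h.lintegral_regret_eq_zero hV hα hγ0 hγ1 hr hR (t := 0) (by simp)
  have hfst : (initLaw π (Measure.dirac s)).map Prod.fst = Measure.dirac s :=
    Measure.fst_compProd _ π.kernel
  rw [stateActionLaw_zero, ← lintegral_map hreg measurable_fst, hfst, lintegral_dirac' _ hreg] at h1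
  exact h1

/-- If the future regret of an energy-based policy is at most `c`, then the regret from the current
state on is at most `c`. -/
lemma regret_add_lintegral_discountedRegret_le (hV : IsSoftValue ν P r γ α V) (hα : 0 < α)
    (hγ0 : 0 ≤ γ) (hγ1 : γ < 1) (hr : Measurable (Function.uncurry r)) (hR : ∀ s a, |r s a| ≤ R)
    {c : ℝ} (hc0 : 0 ≤ c) {s : S}
    (hc : ∀ a, discountedRegret P r γ α V π 1 (s, a) ≤ ENNReal.ofReal c)
    (hs : IsEnergyBasedAt P r γ α π s) :
    regret P r γ α V π s + ∫⁻ a, discountedRegret P r γ α V π 1 (s, a) ∂π.kernel s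
      ≤ ENNReal.ofReal c := by
  obtain ⟨C, hC⟩ := hV.exists_abs_qOf_le hγ0 hR
  have hqm : Measurable (qOf P r γ V s) :=
    (measurable_qOf (P := P) (γ := γ) hr hV.measurable).comp measurable_prodMk_left
  have hDm : Measurable fun a => discountedRegret P r γ α V π 1 (s, a) :=
    (measurable_discountedRegret hr hV.measurable π 1).comp measurable_prodMk_left
  set d : A → ℝ := fun a => (discountedRegret P r γ α V π 1 (s, a)).toReal with hd
  have hdm : Measurable d := hDm.ennreal_toReal
  have hd0 : ∀ a, 0 ≤ d a := fun a => ENNReal.toReal_nonneg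
  have hdc : ∀ a, d a ≤ c := fun a => ENNReal.toReal_le_of_le_ofReal hc0 (hc a)
  have hDd : ∀ a, discountedRegret P r γ α V π 1 (s, a) = ENNReal.ofReal (d a) := fun a =>
    (ENNReal.ofReal_toReal (ne_top_of_le_ne_top ENNReal.ofReal_ne_top (hc a))).symm
  have hQ : ∀ a, (softQ P r γ α π s a).toReal = qOf P r γ V s a - d a := fun a => by
    rw [softQ_eq_sub_discountedRegret hV hα hγ0 hγ1 hr hR, hDd, EReal.coe_ennreal_ofReal,
      max_eq_left (hd0 a), ← EReal.coe_sub, EReal.toReal_coe]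
  obtain ⟨hfi, hf1⟩ := integrable_of_lintegral_ofReal_eq_one (π.measurable_dens_apply s)
    (π.nonneg s) (π.lintegral_eq_one s)
  -- `V` and `softV` are the log-partition functions of `q` and `q - d`, with `d ≤ c`.
  have hVs : V s - softV P r γ α π s ≤ c := by
    have h := softMax_le_add (ν := ν) hα (q := qOf P r γ V) (s := s)
      (q' := fun s a => (softQ P r γ α π s a).toReal) (c := c) hqm
      (by simp_rw [hQ]; exact hqm.sub hdm) (hC s) (C' := C + c) (fun a => by
        rw [hQ]
        refine (abs_sub _ _).trans (add_le_add (hC s a) ?_)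
        rw [abs_of_nonneg (hd0 a)]; exact hdc a)
      (ae_of_all _ fun a => by rw [hQ]; linarith [hdc a])
    rw [← hV.eq_softMax s] at h
    have : softMax ν α (fun s a => (softQ P r γ α π s a).toReal) s = softV P r γ α π s := rfl
    linarith
  set u := gibbsLog P r γ α V s with hu
  have hum : Measurable u := measurable_gibbsLog_apply hr hV.measurable s
  have hexp1 := hV.integral_exp_gibbsLog hα hγ0 hr hR s
  have hexpi : Integrable (fun a => Real.exp (u a)) ν := by
    by_contra h
    rw [integral_undef h] at hexp1
    exact zero_ne_one hexp1
  have hφm := measurable_entropyBregman (π.measurable_dens_apply s) hum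
  set F : A → ℝ := fun a => α * entropyBregman (π.dens s a) (u a) + π.dens s a * d a with hF
  have hF0 : ∀ a, 0 ≤ F a := fun a =>
    add_nonneg (mul_nonneg hα.le (entropyBregman_nonneg (π.nonneg s a) _))
      (mul_nonneg (π.nonneg s a) (hd0 a))
  -- The key cancellation: the energy-based form gives `α (log π - u) = V - softV - d`, so the
  -- future regret `π d` drops out. The remaining terms integrate to `V - softV`, as `π` and `exp u`
  -- have mass `1`.
  have hFG : F =ᵐ[ν] fun a => π.dens s a * (V s - softV P r γ α π s)
      + (α * Real.exp (u a) - α * π.dens s a) := by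
    filter_upwards [hs.2.2] with a ha
    have hlog : α * Real.log (π.dens s a) = qOf P r γ V s a - d a - softV P r γ α π s := by
      rw [ha, Real.log_exp, hQ, mul_div_cancel₀ _ hα.ne']
    have hlu : α * u a = qOf P r γ V s a - V s := by
      rw [hu, gibbsLog, mul_div_cancel₀ _ hα.ne']
    simp only [hF, entropyBregman]
    linear_combination π.dens s a * hlog - π.dens s a * hlu
  have hdiff : Integrable (fun a => α * Real.exp (u a) - α * π.dens s a) ν :=
    (hexpi.const_mul α).sub (hfi.const_mul α)
  have hFi : Integrable F ν := ((hfi.mul_const _).add hdiff).congr hFG.symm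
  have hFint : ∫ a, F a ∂ν = V s - softV P r γ α π s := by
    rw [integral_congr_ae hFG, integral_add (hfi.mul_const _) hdiff,
      integral_sub (hexpi.const_mul α) (hfi.const_mul α), integral_mul_const,
      integral_const_mul, integral_const_mul, hf1, hexp1]
    ring
  have hsum : regret P r γ α V π s + ∫⁻ a, discountedRegret P r γ α V π 1 (s, a) ∂π.kernel s
      = ∫⁻ a, ENNReal.ofReal (F a) ∂ν := by
    rw [regret, gibbsGap, π.lintegral_kernel s hDm, ← lintegral_const_mul _ hφm.ennreal_ofReal,
      ← lintegral_add_left (hφm.ennreal_ofReal.const_mul _)]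
    refine lintegral_congr fun a => ?_
    rw [hDd, ← ENNReal.ofReal_mul hα.le, ← ENNReal.ofReal_mul (π.nonneg s a),
      ← ENNReal.ofReal_add (mul_nonneg hα.le (entropyBregman_nonneg (π.nonneg s a) _))
      (mul_nonneg (π.nonneg s a) (hd0 a))]
  rw [hsum, ← ofReal_integral_eq_lintegral_ofReal hFi (ae_of_all _ hF0), hFint]
  exact ENNReal.ofReal_le_ofReal hVs

/-- A policy with a bounded soft Q-function that is energy-based everywhere has no future regret. -/
lemma discountedRegret_eq_zero_of_isEnergyBasedAt (hV : IsSoftValue ν P r γ α V) (hα : 0 < α)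
    (hγ0 : 0 ≤ γ) (hγ1 : γ < 1) (hr : Measurable (Function.uncurry r)) (hR : ∀ s a, |r s a| ≤ R)
    (hb : HasBoundedSoftQ P r γ α π) (he : ∀ s, IsEnergyBasedAt P r γ α π s) (x : S × A) :
    discountedRegret P r γ α V π 1 x = 0 := by
  obtain ⟨C, hC⟩ := hV.exists_abs_qOf_le hγ0 hR
  obtain ⟨B, hB⟩ := hb
  -- Since `q` is bounded above, the lower bound on the soft Q-function gives the finite constant
  -- from which the iteration starts.
  have hbound : ∀ x, discountedRegret P r γ α V π 1 x ≤ ENNReal.ofReal (max (C + B) 0) := by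
    rintro ⟨s, a⟩
    have h1 := (hB s a).1
    rw [softQ_eq_sub_discountedRegret hV hα hγ0 hγ1 hr hR] at h1
    induction h : discountedRegret P r γ α V π 1 (s, a) with
    | top => rw [h] at h1; simp at h1
    | coe d =>
      have e : ((d : ℝ≥0∞) : EReal) = ((d : ℝ) : EReal) := rfl
      rw [h, e, ← EReal.coe_sub, EReal.coe_le_coe_iff] at h1
      rw [← ENNReal.ofReal_coe_nnreal]
      refine ENNReal.ofReal_le_ofReal (le_max_of_le_left ?_)
      linarith [(abs_le.1 (hC s a)).2]
  set c := max (C + B) 0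
  have hc0 : 0 ≤ c := le_max_right _ _
  have hDm := measurable_discountedRegret (P := P) (γ := γ) (α := α) hr hV.measurable π 1
  have hreg := measurable_regret (P := P) (γ := γ) (α := α) hr hV.measurable π
  have hiter : ∀ n : ℕ, ∀ x, discountedRegret P r γ α V π 1 x ≤ ENNReal.ofReal (γ ^ n * c) := by
    intro n
    induction n with
    | zero => simpa using hbound
    | succ n ih =>
      intro x
      rw [discountedRegret_one_eq hγ0 hr hV.measurable, pow_succ', mul_assoc,
        ENNReal.ofReal_mul hγ0, stepExp,
        lintegral_stepKernel (f := fun y => regret P r γ α V π y.1 +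
          discountedRegret P r γ α V π 1 y) ((hreg.comp measurable_fst).add hDm)]
      gcongr
      calc ∫⁻ s, ∫⁻ a, regret P r γ α V π s + discountedRegret P r γ α V π 1 (s, a) ∂π.kernel s ∂P x
          ≤ ∫⁻ _, ENNReal.ofReal (γ ^ n * c) ∂P x := by
            refine lintegral_mono fun s => ?_
            rw [lintegral_add_left measurable_const, lintegral_const, measure_univ, mul_one]
            exact regret_add_lintegral_discountedRegret_le hV hα hγ0 hγ1 hr hR
              (mul_nonneg (pow_nonneg hγ0 n) hc0) (fun a => ih (s, a)) (he s)
        _ = ENNReal.ofReal (γ ^ n * c) := by simp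
  have hlim : Filter.Tendsto (fun n : ℕ => ENNReal.ofReal (γ ^ n * c)) Filter.atTop (nhds 0) := by
    have := ENNReal.tendsto_ofReal ((tendsto_pow_atTop_nhds_zero_of_lt_one hγ0 hγ1).mul_const c)
    simpa using this
  exact le_antisymm (ge_of_tendsto hlim (.of_forall fun n => hiter n x)) bot_le

/-- Without future regret the soft Q-function is `q` and `softV` is `V`, so the energy-based form is
the Gibbs density. -/
lemma regret_eq_zero_of_isEnergyBasedAt (hV : IsSoftValue ν P r γ α V) (hα : 0 < α)
    (hγ0 : 0 ≤ γ) (hγ1 : γ < 1) (hr : Measurable (Function.uncurry r)) (hR : ∀ s a, |r s a| ≤ R)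
    (hb : HasBoundedSoftQ P r γ α π) (he : ∀ s, IsEnergyBasedAt P r γ α π s) (s : S) :
    regret P r γ α V π s = 0 := by
  have hQ : ∀ a, softQ P r γ α π s a = (qOf P r γ V s a : EReal) := fun a =>
    softQ_eq_qOf hV hα hγ0 hγ1 hr hR
      (discountedRegret_eq_zero_of_isEnergyBasedAt hV hα hγ0 hγ1 hr hR hb he _)
  rw [regret_eq_zero_iff hα hr hV.measurable]
  filter_upwards [(he s).2.2] with a ha
  rw [ha, softV_eq_of_ae hV (ae_of_all _ hQ), hQ, EReal.toReal_coe, gibbsLog]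

lemma hasBoundedSoftQ_of_regret_eq_zero (hV : IsSoftValue ν P r γ α V) (hα : 0 < α)
    (hγ0 : 0 ≤ γ) (hγ1 : γ < 1) (hr : Measurable (Function.uncurry r)) (hR : ∀ s a, |r s a| ≤ R)
    (h : ∀ s, regret P r γ α V π s = 0) : HasBoundedSoftQ P r γ α π := by
  obtain ⟨C, hC⟩ := hV.exists_abs_qOf_le hγ0 hR
  refine ⟨C, fun s a => ?_⟩
  rw [softQ_eq_qOf hV hα hγ0 hγ1 hr hR (discountedRegret_eq_zero h 1 _), EReal.coe_le_coe_iff,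
    EReal.coe_le_coe_iff]
  exact abs_le.1 (hC s a)

/-- A policy that is optimal from `ρ₀` is energy-based wherever it goes. -/
lemma IsMaxEntOptimal.ae_isEnergyBasedAt {ρ₀ : Measure S} [IsProbabilityMeasure ρ₀]
    (h : IsMaxEntOptimal P r γ α ρ₀ π) (hV : IsSoftValue ν P r γ α V) (hα : 0 < α)
    (hγ0 : 0 ≤ γ) (hγ1 : γ < 1) (hr : Measurable (Function.uncurry r)) (hR : ∀ s a, |r s a| ≤ R)
    {t : ℕ} (ht : 0 < γ ^ t) : ∀ᵐ s ∂stateLaw P π ρ₀ t, IsEnergyBasedAt P r γ α π s := by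
  have hreg := measurable_regret (P := P) (γ := γ) (α := α) hr hV.measurable π
  have hreg' : Measurable fun x : S × A => regret P r γ α V π x.1 := hreg.comp measurable_fst
  have hDm := measurable_discountedRegret (P := P) (γ := γ) (α := α) hr hV.measurable π 1
  set M := stateActionLaw P π (initLaw π ρ₀) t with hM
  have hprob := Measure.isProbabilityMeasure_map (μ := M)
    (measurable_fst (α := S) (β := A)).aemeasurable
  have h1 : ∀ᵐ s ∂M.map Prod.fst, regret P r γ α V π s = 0 := by
    have := h.lintegral_regret_eq_zero hV hα hγ0 hγ1 hr hR ht
    rw [← hM, ← lintegral_map hreg measurable_fst, lintegral_eq_zero_iff hreg] at this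
    exact this
  -- The mean future regret at time `t` is a weighted sum of mean regrets at times `t + 1 + l`.
  -- These vanish by optimality if `γ > 0`, and the weights vanish if `γ = 0`.
  have h2 : ∫⁻ x, discountedRegret P r γ α V π 1 x ∂M = 0 := by
    simp only [discountedRegret]
    rw [lintegral_tsum fun l => ((measurable_stepExp_iterate hreg' _).const_mul _).aemeasurable]
    refine ENNReal.tsum_eq_zero.2 fun l => ?_
    rw [lintegral_const_mul _ (measurable_stepExp_iterate hreg' _),
      ← lintegral_stateActionLaw_add hreg', mul_eq_zero]
    rcases hγ0.eq_or_lt with h0 | h0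
    · left; rw [← h0]; simp [pow_add]
    · right; exact h.lintegral_regret_eq_zero hV hα hγ0 hγ1 hr hR (pow_pos h0 _)
  have hfollow : FollowsPolicy π M := (followsPolicy_initLaw ρ₀).stateActionLaw t
  have h3 : ∀ᵐ s ∂M.map Prod.fst,
      ∫⁻ a, discountedRegret P r γ α V π 1 (s, a) ∂π.kernel s = 0 := by
    rw [hfollow, Measure.lintegral_compProd hDm,
      lintegral_eq_zero_iff hDm.lintegral_kernel_prod_right'] at h2
    exact h2
  rw [stateLaw_eq, ← hM]
  filter_upwards [h1, h3] with s hs1 hs3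
  have hDs : Measurable fun a => discountedRegret P r γ α V π 1 (s, a) :=
    hDm.comp measurable_prodMk_left
  rw [π.lintegral_kernel s hDs, lintegral_eq_zero_iff
    (f := fun a => ENNReal.ofReal (π.dens s a) * discountedRegret P r γ α V π 1 (s, a))
    ((π.measurable_dens_apply s).ennreal_ofReal.mul hDs)] at hs3
  refine isEnergyBasedAt_of_ae hV hα hγ0 hr hR ?_ hs1
  -- Zero regret makes the density an exponential, hence positive, so a property holding for `π(· |
  -- s)`-almost every action holds for `ν`-almost every one.
  filter_upwards [hs3, (regret_eq_zero_iff hα hr hV.measurable π s).1 hs1] with a ha hp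
  refine softQ_eq_qOf hV hα hγ0 hγ1 hr hR ((mul_eq_zero.1 ha).resolve_left ?_)
  rw [hp]
  simpa using Real.exp_pos _

end Optimality

end

end MaxEntRL

/-! ### The main theorem. -/

theorem theorem1 {S A : Type*} [MeasurableSpace S] [MeasurableSpace A]
    (ν : Measure A) [IsFiniteMeasure ν] [NeZero ν]
    (P : Kernel (S × A) S) [IsMarkovKernel P]
    (r : S → A → ℝ) (hr : Measurable (Function.uncurry r))
    (rmin rmax : ℝ) (hrb : ∀ s a, r s a ∈ Set.Icc rmin rmax)
    (γ α : ℝ) (hγ0 : 0 ≤ γ) (hγ1 : γ < 1) (hα : 0 < α) :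
    -- an optimal policy exists, and it is the energy-based policy of its own soft Q-function
    (∃ π : MaxEntRL.Policy S ν,
      (∀ ρ₀ : Measure S, IsProbabilityMeasure ρ₀ → MaxEntRL.IsMaxEntOptimal P r γ α ρ₀ π) ∧
      (∀ (π' : MaxEntRL.Policy S ν) (s : S) (a : A),
        MaxEntRL.softQ P r γ α π' s a ≤ MaxEntRL.softQ P r γ α π s a) ∧
      MaxEntRL.HasBoundedSoftQ P r γ α π ∧
      (∀ s, Integrable (fun a => Real.exp ((MaxEntRL.softQ P r γ α π s a).toReal / α)) ν) ∧
      ∀ s a, π.dens s a =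
        Real.exp (((MaxEntRL.softQ P r γ α π s a).toReal - MaxEntRL.softV P r γ α π s) / α)) ∧
    -- the policies that are optimal from every initial distribution are exactly these
    (∀ π : MaxEntRL.Policy S ν,
      (∀ ρ₀ : Measure S, IsProbabilityMeasure ρ₀ → MaxEntRL.IsMaxEntOptimal P r γ α ρ₀ π) ↔
        (MaxEntRL.HasBoundedSoftQ P r γ α π ∧
          ∀ s, MaxEntRL.IsEnergyBasedAt P r γ α π s)) ∧
    -- a policy that is optimal from one initial distribution has this form wherever it goes
    (∀ ρ₀ : Measure S, IsProbabilityMeasure ρ₀ → ∀ π : MaxEntRL.Policy S ν,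
      MaxEntRL.IsMaxEntOptimal P r γ α ρ₀ π →
        ∀ t : ℕ, 0 < γ ^ t → ∀ᵐ s ∂(MaxEntRL.stateLaw P π ρ₀ t),
          MaxEntRL.IsEnergyBasedAt P r γ α π s) := by
  obtain ⟨R, hR0, hR⟩ : ∃ R : ℝ, 0 ≤ R ∧ ∀ s a, |r s a| ≤ R :=
    ⟨max |rmin| |rmax|, le_max_of_le_left (abs_nonneg _),
      fun s a => abs_le_max_abs_abs (hrb s a).1 (hrb s a).2⟩
  obtain ⟨V, hV⟩ := MaxEntRL.exists_isSoftValue (ν := ν) (P := P) hα hγ0 hγ1 hr hR0 hR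
  refine ⟨?_, fun π => ⟨fun h => ?_, fun h ρ₀ hρ₀ => ?_⟩, fun ρ₀ hρ₀ π h t ht => ?_⟩
  · have h0 := MaxEntRL.regret_gibbsPolicy hV hα hγ0 hr hR
    have hQ : ∀ s a, MaxEntRL.softQ P r γ α (MaxEntRL.gibbsPolicy hV hα hγ0 hr hR) s a
        = (MaxEntRL.qOf P r γ V s a : EReal) := fun s a =>
      MaxEntRL.softQ_eq_qOf hV hα hγ0 hγ1 hr hR (MaxEntRL.discountedRegret_eq_zero h0 1 _)
    refine ⟨MaxEntRL.gibbsPolicy hV hα hγ0 hr hR, fun ρ₀ hρ₀ => ?_, fun π' s a => ?_, ?_,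
      fun s => ?_, fun s a => ?_⟩
    · exact MaxEntRL.isMaxEntOptimal_of_regret_eq_zero hV hα hγ0 hγ1 hr hR h0 ρ₀
    · rw [hQ, MaxEntRL.softQ_eq_sub_discountedRegret hV hα hγ0 hγ1 hr hR]
      exact MaxEntRL.coe_sub_coe_le _ _
    · exact MaxEntRL.hasBoundedSoftQ_of_regret_eq_zero hV hα hγ0 hγ1 hr hR h0
    · exact (MaxEntRL.isEnergyBasedAt_of_ae hV hα hγ0 hr hR (ae_of_all _ (hQ s)) (h0 s)).2.1
    · rw [MaxEntRL.softV_eq_of_ae hV (ae_of_all _ (hQ s)), hQ, EReal.toReal_coe]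
      rfl
  -- Optimality is used only from the point masses.
  · have h0 : ∀ s, MaxEntRL.regret P r γ α V π s = 0 := fun s =>
      MaxEntRL.regret_eq_zero_of_optimal hV hα hγ0 hγ1 hr hR (h _ inferInstance)
    refine ⟨MaxEntRL.hasBoundedSoftQ_of_regret_eq_zero hV hα hγ0 hγ1 hr hR h0, fun s => ?_⟩
    exact MaxEntRL.isEnergyBasedAt_of_ae hV hα hγ0 hr hR (ae_of_all _ fun a =>
      MaxEntRL.softQ_eq_qOf hV hα hγ0 hγ1 hr hR (MaxEntRL.discountedRegret_eq_zero h0 1 _)) (h0 s)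
  · exact MaxEntRL.isMaxEntOptimal_of_regret_eq_zero hV hα hγ0 hγ1 hr hR
      (MaxEntRL.regret_eq_zero_of_isEnergyBasedAt hV hα hγ0 hγ1 hr hR h.1 h.2) ρ₀
  · exact h.ae_isEnergyBasedAt hV hα hγ0 hγ1 hr hR ht
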